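/- **Setting.** Write $z=(x,y)\in\mathbb R^n\times\mathbb R^m$, use Euclidean norms for vectors and operator norms for multilinear forms, and for $f:\mathbb R^n\times\mathbb R^m\to\mathbb R$ put $F_f(z)=(\nabla_xf(z),-\nabla_yf(z))$ and $m_f(z)=\frac12\|F_f(z)\|^2$. A point $(x^*,y^*)$ is a saddle (min-max) point of $f$ if $f(x^*,y)\le f(x,y^*)$ for all $x,y$. Let $\Phi^f_{z,k}(w)=\sum_{i=0}^k\frac1{i!}\nabla^if(z)[w-z]^i$ be the Taylor approximation. Let $p\ge1$, let $g:\mathbb R^n\times\mathbb R^m\to\mathbb R$ be convex in $x$, concave in $y$ and $\max\{p,2\}$ times continuously differentiable, and let $L_1,L_2,L_p>0$ be Lipschitz constants of $\nabla g$, $\nabla^2g$ and $\nabla^pg$. Let $z^*$ be a saddle point of $g$, $R>0$, $\|z_1-z^*\|\le R$, $\varepsilon_\nabla>0$, $\rho,\alpha\in(0,1)$; if $p=1$, assume also $\varepsilon_\nabla\le4RL_p$. Put $$\mu=\frac{\varepsilon_\nabla}{4R},\quad \xi=\max\Big\{1,\frac{4RL_1}{\varepsilon_\nabla}\Big\},\quad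 M=\sqrt2\,pL_p,\quad \varepsilon'=\frac{\varepsilon_\nabla^{\frac{p+1}p}}{2^{\frac{2p^2+3p+3}{2p}}\,p\,(p+1)!\,M^{1/p}},$$ $$g_\mu(x,y)=g(x,y)+\frac\mu2\big(\|x-x_1\|^2-\|y-y_1\|^2\big),\qquad F=F_{g_\mu}.$$ **Method.** (1) *Restarted high-order Mirror-Prox.* Let $\tilde z_1=z_1$ and $N_0=\max\{0,\lceil\log_2\frac{L_2R\xi}\mu+1\rceil\}$. For $i=1,\dots,N_0$ let $R_i=R/2^{i-1}$, $T_i=\big\lceil\big(\frac{64L_pR_i^{p-1}}\mu\big)^{\frac2{p+1}}\big\rceil$, and let $\tilde z_{i+1}$ be the result of $T_i$ iterations of Mirror-Prox for $F$ started at $u_1=\tilde z_i$: for $t=1,\dots,T_i$ determine $\gamma_t>0$ and $\hat u_t$ with $$\hat u_t=\arg\min_u\big\{\gamma_t\langle\Phi^F_{u_t,p-1}(\hat u_t),u-u_t\rangle+\tfrac12\|u-u_t\|^2\big\},\quad \frac{p!}{32L_p\|\hat u_t-u_t\|^{p-1}}\le\gamma_t\le\frac{p!}{16L_p\|\hat u_t-u_t\|^{p-1}},$$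 $$u_{t+1}=\arg\min_u\big\{\langle\gamma_tF(\hat u_t),u-\hat u_t\rangle+\tfrac12\|u-u_t\|^2\big\};$$ the result is $\big(\sum_t\gamma_t\big)^{-1}\sum_t\gamma_t\hat u_t$ (or an iterate $u_s$ with $F(u_s)=0$, if one is met). (2) *Cubic-regularized Newton method (CRN-SPP)* for $g_\mu$, started at $w_0=\tilde z_{N_0+1}$, with stopping criterion $m_{g_\mu}(w_k)\le\frac{\mu^2\varepsilon'}{L_1+\mu}$. Each iteration $w_k\mapsto w_{k+1}$ tries $\gamma=\bar\gamma,\rho\bar\gamma,\rho^2\bar\gamma,\dots$ with $\bar\gamma=\frac{L_2\mu^2}{2L_1^2}$, where the trial point $w$ is a saddle point of $$\Phi^{g_\mu}_{w_k,2}(x,y)+\frac\gamma3\|x-x_{w_k}\|^3-\frac\gamma3\|y-y_{w_k}\|^3,$$ until $\gamma(\|x_w-x_{w_k}\|+\|y_w-y_{w_k}\|)\le\mu$. With $d_k=w-w_k$ for the accepted $w$, it sets $w_{k+1}=w_k+\alpha d_k$ if $m_{g_\mu}(w_k+\alpha d_k)<m_{g_\mu}(w_k+d_k)$, and $w_{k+1}=w_k+d_k$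 otherwise. (3) *Tensor step.* If the method of step (2) stops at $w_k=(x_k,y_k)$, the output is $\tilde z=T^{g_\mu}_{p,M}(w_k)$, any saddle point of $$\Phi^{g_\mu}_{w_k,p}(x,y)+\frac{M(\sqrt2)^{p-1}}{(p+1)!}\|x-x_k\|^{p+1}-\frac{M(\sqrt2)^{p-1}}{(p+1)!}\|y-y_k\|^{p+1}.$$ **Theorem.** Every output $\tilde z$ of the method satisfies $\|\nabla g(\tilde z)\|\le\varepsilon_\nabla$. Moreover, there is a constant $C$ that depends only on $p$ such that in every run, completed or not, in which step (2) has made $k$ iterations, the total number of iterations is bounded by $$\sum_{i=1}^{N_0}T_i+k+1\;\le\;C\,\max\Big\{1,\frac{L_pR^p}{\varepsilon_\nabla}\Big\}^{\frac2{p+1}}\max\Big\{1,\log\frac{L_2R^2\xi}{\varepsilon_\nabla}\Big\},$$ that is, the complexity is $O\big(\big(\frac{L_pR^p}{\varepsilon_\nabla}\big)^{\frac2{p+1}}\log\frac{L_2R^2\xi}{\varepsilon_\nabla}\big)$. -/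

import Mathlib

open scoped Gradient Nat

noncomputable section

/-- The space `ℝⁿ × ℝᵐ` of pairs `z = (x, y)` with its Euclidean norm. -/
abbrev Pair (n m : ℕ) : Type :=
  WithLp 2 (EuclideanSpace ℝ (Fin n) × EuclideanSpace ℝ (Fin m))

/-- The pair `(x, y)` as a point of `ℝⁿ × ℝᵐ`. -/
def mkPair {n m : ℕ} (x : EuclideanSpace ℝ (Fin n)) (y : EuclideanSpace ℝ (Fin m)) : Pair n m :=
  WithLp.toLp 2 (x, y)

/-- `z = (x, y)` is a saddle point of `min_x max_y g(x, y)`, that is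
`g(x, y') ≤ g(x', y)` for all `x'` and `y'`. -/
def IsSaddle {n m : ℕ} (g : Pair n m → ℝ) (z : Pair n m) : Prop :=
  IsSaddlePointOn Set.univ Set.univ (fun x y => g (mkPair x y)) z.fst z.snd

/-- `g` is convex in `x` and concave in `y`. -/
def ConvexConcave {n m : ℕ} (g : Pair n m → ℝ) : Prop :=
  (∀ y, ConvexOn ℝ Set.univ (fun x => g (mkPair x y))) ∧
    ∀ x, ConcaveOn ℝ Set.univ (fun y => g (mkPair x y))

/-- The `k`-th derivative of `g` is `L`-Lipschitz, for the Euclidean norm on points and the operator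
norm on `k`-linear forms. -/
def LipschitzDeriv {n m : ℕ} (k : ℕ) (L : ℝ) (g : Pair n m → ℝ) : Prop :=
  ∀ z w, ‖iteratedFDeriv ℝ k g z - iteratedFDeriv ℝ k g w‖ ≤ L * ‖z - w‖

/-- The operator `F(z) = (∇ₓ g(z), -∇_y g(z))`. -/
def saddleOp {n m : ℕ} (g : Pair n m → ℝ) (z : Pair n m) : Pair n m :=
  mkPair (∇ g z).fst (-(∇ g z).snd)

/-- The merit function `½ ‖F(z)‖²`. -/
def merit {n m : ℕ} (g : Pair n m → ℝ) (z : Pair n m) : ℝ :=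
  1 / 2 * ‖saddleOp g z‖ ^ 2

/-- The Taylor approximation of `f` at `z` up to the order `k`, evaluated at `w`. -/
def taylorApprox {E G : Type*} [NormedAddCommGroup E] [NormedSpace ℝ E]
    [NormedAddCommGroup G] [NormedSpace ℝ G] (f : E → G) (k : ℕ) (z w : E) : G :=
  ∑ i ∈ Finset.range (k + 1), ((1 : ℝ) / (i ! : ℝ)) • iteratedFDeriv ℝ i f z (fun _ => w - z)

/-! ### High-order Mirror-Prox -/

/-- One iteration of the high-order Mirror-Prox method for the operator `F`, from the point `z`
to the point `z'`, with step size `γ` and intermediate point `zh`. The two-sided condition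
`p! / (32 L ‖zh - z‖ ^ (p - 1)) ≤ γ ≤ p! / (16 L ‖zh - z‖ ^ (p - 1))`
is written without division. As the `(p - 1)`-st derivative of `F` is Lipschitz, the Taylor
approximation of `F` has order `p - 1`. -/
structure MirrorProxStep {n m : ℕ} (F : Pair n m → Pair n m) (p : ℕ) (L : ℝ)
    (z : Pair n m) (γ : ℝ) (zh z' : Pair n m) : Prop where
  pos : 0 < γ
  argmin_mid : IsMinOn
    (fun w => γ * inner ℝ (taylorApprox F (p - 1) z zh) (w - z) + 1 / 2 * ‖w - z‖ ^ 2)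
    Set.univ zh
  lower : (p ! : ℝ) ≤ 32 * L * ‖zh - z‖ ^ (p - 1) * γ
  upper : 16 * L * ‖zh - z‖ ^ (p - 1) * γ ≤ (p ! : ℝ)
  argmin_next : IsMinOn
    (fun w => inner ℝ (γ • F zh) (w - zh) + 1 / 2 * ‖w - z‖ ^ 2) Set.univ z'

/-- `out` is a result of `T` iterations of the high-order Mirror-Prox method started at `z₁`: the
weighted average of the intermediate points. If an iterate `z s` with `F (z s) = 0` is met, then
the problem is solved (and the bounds on the step size are infinite), and the method may return
this iterate. -/
def IsMirrorProxOutput {n m : ℕ} (F : Pair n m → Pair n m) (p : ℕ) (L : ℝ) (T : ℕ)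
    (z₁ out : Pair n m) : Prop :=
  ∃ (z zh : ℕ → Pair n m) (γ : ℕ → ℝ), z 0 = z₁ ∧
    (((∀ t < T, MirrorProxStep F p L (z t) (γ t) (zh t) (z (t + 1))) ∧
        out = (∑ t ∈ Finset.range T, γ t)⁻¹ • ∑ t ∈ Finset.range T, γ t • zh t) ∨
      ∃ s < T, (∀ t < s, MirrorProxStep F p L (z t) (γ t) (zh t) (z (t + 1))) ∧
        F (z s) = 0 ∧ out = z s)

/-! ### The cubic-regularized Newton method for saddle points -/

/-- The cubic-regularized second order model of `g` at `z`. -/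
def cubicModel {n m : ℕ} (g : Pair n m → ℝ) (γ : ℝ) (z w : Pair n m) : ℝ :=
  taylorApprox g 2 z w + γ / 3 * ‖w.fst - z.fst‖ ^ 3 - γ / 3 * ‖w.snd - z.snd‖ ^ 3

/-- One (outer) iteration `z ↦ z'` of the cubic-regularized Newton method for a
`μ`-strongly-convex-strongly-concave `g`. The regularization parameter starts at `γbar` and is
multiplied by `ρ` until `γ (‖x̃ - x‖ + ‖ỹ - y‖) ≤ μ` holds for the saddle point `(x̃, ỹ)` of the
model; `trial i` is this saddle point for the parameter `γbar * ρ ^ i`, and `trial j` is the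
accepted one. Then the better of the steps `α d` and `d` is made. -/
def CubicNewtonStep {n m : ℕ} (g : Pair n m → ℝ) (μ γbar ρ α : ℝ) (z z' : Pair n m) : Prop :=
  ∃ (j : ℕ) (trial : ℕ → Pair n m),
    (∀ i ≤ j, IsSaddle (cubicModel g (γbar * ρ ^ i) z) (trial i)) ∧
    (∀ i < j, μ < γbar * ρ ^ i * (‖(trial i).fst - z.fst‖ + ‖(trial i).snd - z.snd‖)) ∧
    γbar * ρ ^ j * (‖(trial j).fst - z.fst‖ + ‖(trial j).snd - z.snd‖) ≤ μ ∧
    ((merit g (z + α • (trial j - z)) < merit g (z + (trial j - z)) ∧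
        z' = z + α • (trial j - z)) ∨
      (merit g (z + (trial j - z)) ≤ merit g (z + α • (trial j - z)) ∧
        z' = z + (trial j - z)))

/-! ### The tensor step -/

/-- The regularized Taylor approximation of `g` of order `p` at `z`. -/
def tensorModel {n m : ℕ} (g : Pair n m → ℝ) (p : ℕ) (M : ℝ) (z w : Pair n m) : ℝ :=
  taylorApprox g p z w
    + M * Real.sqrt 2 ^ (p - 1) / ((p + 1)! : ℝ) * ‖w.fst - z.fst‖ ^ (p + 1)
    - M * Real.sqrt 2 ^ (p - 1) / ((p + 1)! : ℝ) * ‖w.snd - z.snd‖ ^ (p + 1)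

/-- `w` is a value of the tensor step `T_{p,M}` for `g` at `z`: a min-max point of the model. -/
def IsTensorStep {n m : ℕ} (g : Pair n m → ℝ) (p : ℕ) (M : ℝ) (z w : Pair n m) : Prop :=
  IsSaddle (tensorModel g p M z) w

/-! ### The method for gradient norm minimization -/

/-- The numerical input of the method: the order `p`, the Lipschitz constants `L1`, `L2`, `Lp` of
the first, second and `p`-th derivative, the bound `R` on the initial distance to the solution,
the accuracy `ε`, and the parameters `ρ`, `α` of the cubic-regularized Newton method. -/
structure Params where
  p : ℕ
  L1 : ℝ
  L2 : ℝ
  Lp : ℝ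
  R : ℝ
  ε : ℝ
  ρ : ℝ
  α : ℝ

namespace Params

variable (P : Params)

/-- The regularization parameter. -/
def μ : ℝ := P.ε / (4 * P.R)

/-- `ξ = max {1, 4 R L₁ / ε}`. -/
def ξ : ℝ := max 1 (4 * P.R * P.L1 / P.ε)

/-- The parameter of the tensor step. -/
def M : ℝ := Real.sqrt 2 * (P.p : ℝ) * P.Lp

/-- The accuracy `ε'` in terms of the duality gap of the regularized problem. -/
def gapAccuracy : ℝ :=
  P.ε ^ (((P.p : ℝ) + 1) / P.p) /
    ((2 : ℝ) ^ ((2 * (P.p : ℝ) ^ 2 + 3 * P.p + 3) / (2 * P.p)) * P.p * ((P.p + 1)! : ℝ) *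
      P.M ^ (1 / (P.p : ℝ)))

/-- The accuracy in terms of the merit function that is passed to the cubic-regularized Newton
method; `L1 + μ` is the Lipschitz constant of the gradient of the regularized function. -/
def meritAccuracy : ℝ := P.μ ^ 2 * P.gapAccuracy / (P.L1 + P.μ)

/-- The initial parameter of the cubic-regularized Newton method. -/
def γbar : ℝ := P.L2 * P.μ ^ 2 / (2 * P.L1 ^ 2)

/-- The number of restarts (none if the expression is not positive). -/
def restarts : ℕ := ⌈Real.logb 2 (P.L2 * P.R * P.ξ / P.μ) + 1⌉₊

/-- The number of Mirror-Prox iterations of the restart with index `i` (starting from `0`), where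
the distance to the solution is at most `R / 2 ^ i`. -/
def innerIters (i : ℕ) : ℕ :=
  ⌈(64 * P.Lp * (P.R / 2 ^ i) ^ (P.p - 1) / P.μ) ^ ((2 : ℝ) / ((P.p : ℝ) + 1))⌉₊

end Params

/-- The regularized function `g_μ(x, y) = g(x, y) + μ/2 (‖x - x₁‖² - ‖y - y₁‖²)`. -/
def regularized {n m : ℕ} (g : Pair n m → ℝ) (μ : ℝ) (z₁ z : Pair n m) : ℝ :=
  g z + μ / 2 * (‖z.fst - z₁.fst‖ ^ 2 - ‖z.snd - z₁.snd‖ ^ 2)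

/-- A run of the method from `z₁`, up to and including the `k`-th iteration of the
cubic-regularized Newton method: `zt i` is the point obtained after `i` restarts of Mirror-Prox,
and `w j` the point obtained after `j` iterations of the cubic-regularized Newton method, which
goes on as long as the merit function exceeds the prescribed accuracy. -/
structure IsRun {n m : ℕ} (P : Params) (g : Pair n m → ℝ) (z₁ : Pair n m)
    (zt w : ℕ → Pair n m) (k : ℕ) : Prop where
  start : zt 0 = z₁
  restart : ∀ i < P.restarts,
    IsMirrorProxOutput (saddleOp (regularized g P.μ z₁)) P.p P.Lp (P.innerIters i)
      (zt i) (zt (i + 1))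
  switch : w 0 = zt P.restarts
  newton : ∀ j < k,
    P.meritAccuracy < merit (regularized g P.μ z₁) (w j) ∧
      CubicNewtonStep (regularized g P.μ z₁) P.μ P.γbar P.ρ P.α (w j) (w (j + 1))

/-- `out` is an output of the method: the run has met the stopping criterion after `k` iterations
of the cubic-regularized Newton method, and `out` is obtained from `w k` by a tensor step. -/
def IsOutput {n m : ℕ} (P : Params) (g : Pair n m → ℝ) (z₁ : Pair n m)
    (w : ℕ → Pair n m) (k : ℕ) (out : Pair n m) : Prop :=
  merit (regularized g P.μ z₁) (w k) ≤ P.meritAccuracy ∧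
    IsTensorStep (regularized g P.μ z₁) P.p P.M (w k) out

/-- The number of iterations made in a run with `k` iterations of the cubic-regularized Newton
method, including the tensor step. -/
def Params.iterations (P : Params) (k : ℕ) : ℕ :=
  ∑ i ∈ Finset.range P.restarts, P.innerIters i + k + 1

end

/-!
The method is analysed through the saddle operator `F` of the regularized function `g_μ`. It is
`μ`-strongly monotone, because the operator of a convex-concave function is monotone, and therefore
has a unique zero `zr`, no farther from `z₁` than `zs`. Taylor's theorem for functions with a
Lipschitz continuous derivative (`norm_sub_taylorApprox_le`) controls `F` by its Taylor
approximations, and a saddle point of a regularized Taylor model of `g_μ` satisfies the equation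
`Φ + c N(h) = 0`, with `Φ` a Taylor approximation of `F` and `N` the operator of the norm power
(`taylorApprox_add_normPowOp_eq_zero`). No convexity of the Taylor models is used.

*Mirror-Prox.* The energy inequality of a step telescopes. It bounds the sum of the squares of the
displacements, so the step sizes are large on average, and by strong monotonicity the weighted
average of the intermediate points halves the distance to `zr`
(`IsMirrorProxOutput.dist_le_half`). After the restarts the distance is at most
`min R (μ / (2 L₂ ξ))`.

*Newton.* From there every accepted step contracts `‖F‖` by the factor `4 / 5`
(`norm_newton_le`). If `L₁ > μ`, the first step moreover makes `‖F‖` quadratic in the distance to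
`zr` (`norm_newton_le_of_close`), which already brings it to the order `ε / ξ`. What remains is a
factor that depends on `L_p R ^ p / ε` only, so that geometric decrease is enough, and the count of
these iterations needs no logarithmic factor (`gapAccuracy_le_of_not_stopped`, `Params.ε_mul_R_le`).

*Tensor step.* Monotonicity of `F` between the two ends of the step bounds its length by the
accuracy `ε'`, and the length bounds `‖F‖` at the output by `3 ε / 8`
(`norm_saddleOp_tensorStep_le`). As `‖∇ g‖ ≤ ‖F‖ + μ ‖out - z₁‖`, `μ ‖out - zr‖ ≤ ‖F‖` and
`μ R = ε / 4`, this gives `‖∇ g‖ ≤ ε`.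
-/

/-! ### Taylor approximations -/

section Taylor

universe u

variable {E G : Type u} [NormedAddCommGroup E] [NormedSpace ℝ E] [NormedAddCommGroup G]
  [NormedSpace ℝ G]

/-- The iterated derivatives of the second derivative inherit its symmetry. -/
theorem iteratedFDeriv_fderiv_fderiv_symm {i : ℕ} {f : E → G} (hf : ContDiff ℝ (i + 2 : ℕ) f)
    (z u v : E) (m : Fin i → E) :
    iteratedFDeriv ℝ i (fderiv ℝ (fderiv ℝ f)) z m u v =
      iteratedFDeriv ℝ i (fderiv ℝ (fderiv ℝ f)) z m v u := by
  have h1 : ContDiff ℝ (i + 1 : ℕ) (fderiv ℝ f) := hf.fderiv_right (by norm_cast)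
  have h2 : ContDiff ℝ (i : ℕ) (fderiv ℝ (fderiv ℝ f)) := h1.fderiv_right (by norm_cast)
  let Φ := (ContinuousLinearMap.flipₗᵢ ℝ E E G).toContinuousLinearEquiv
  have hΦ : Φ ∘ (fderiv ℝ (fderiv ℝ f)) = fderiv ℝ (fderiv ℝ f) := by
    funext x
    ext a b
    have hs : IsSymmSndFDerivAt ℝ f x :=
      hf.contDiffAt.isSymmSndFDerivAt (by simp)
    exact hs b a
  have h3 := ContinuousLinearEquiv.iteratedFDeriv_comp_left (𝕜 := ℝ) (F := E →L[ℝ] E →L[ℝ] G)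
    (G := E →L[ℝ] E →L[ℝ] G) (f := fderiv ℝ (fderiv ℝ f)) (x := z) Φ (i := i)
  rw [hΦ] at h3
  conv_lhs => rw [h3]
  rfl

/-- The derivative of `v ↦ Dⁱ⁺¹ f(z)[v, …, v]` is `(i + 1) Dⁱ⁺¹ f(z)[v, …, v, ·]`. -/
theorem hasFDerivAt_iteratedFDeriv_diag (i : ℕ) :
    ∀ {G : Type u} [NormedAddCommGroup G] [NormedSpace ℝ G] {f : E → G},
      ContDiff ℝ (i + 1 : ℕ) f → ∀ z v : E,
      HasFDerivAt (fun v => iteratedFDeriv ℝ (i + 1) f z (fun _ => v))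
        (((i + 1 : ℕ) : ℝ) • iteratedFDeriv ℝ i (fderiv ℝ f) z (fun _ => v)) v := by
  induction i with
  | zero =>
    intro G _ _ f hf z v
    simpa using (fderiv ℝ f z).hasFDerivAt
  | succ i ih =>
    intro G _ _ f hf z v
    have h1 : ContDiff ℝ (i + 1 : ℕ) (fderiv ℝ f) := hf.fderiv_right (by norm_cast)
    have h2 := (ih h1 z v).clm_apply (hasFDerivAt_id v)
    have h3 : (fun v => iteratedFDeriv ℝ (i + 1 + 1) f z (fun _ => v)) =
        fun v => (iteratedFDeriv ℝ (i + 1) (fderiv ℝ f) z (fun _ => v)) (id v) := by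
      funext v
      rw [iteratedFDeriv_succ_apply_right]
      rfl
    rw [h3]
    convert h2 using 1
    ext u
    have h4 : iteratedFDeriv ℝ i (fderiv ℝ (fderiv ℝ f)) z (fun _ => v) u v =
        iteratedFDeriv ℝ (i + 1) (fderiv ℝ f) z (fun _ => v) u := by
      rw [iteratedFDeriv_fderiv_fderiv_symm hf, iteratedFDeriv_succ_apply_right]
      rfl
    simp [h4, add_smul]
    abel

/-- Differentiation lowers the order of a Taylor approximation by one. -/
theorem hasFDerivAt_taylorApprox {k : ℕ} {f : E → G} (hf : ContDiff ℝ (k + 1 : ℕ) f) (z w : E) :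
    HasFDerivAt (taylorApprox f (k + 1) z) (taylorApprox (fderiv ℝ f) k z w) w := by
  have h : taylorApprox f (k + 1) z = fun w => (∑ i ∈ Finset.range (k + 1),
      ((1 : ℝ) / ((i + 1)! : ℝ)) • iteratedFDeriv ℝ (i + 1) f z (fun _ => w - z)) + f z := by
    funext w
    simp [taylorApprox, Finset.sum_range_succ' _ (k + 1)]
  rw [h]
  refine HasFDerivAt.add_const _ ?_
  unfold taylorApprox
  refine HasFDerivAt.fun_sum fun i hi => ?_
  have hi' : i + 1 ≤ k + 1 := by
    have := Finset.mem_range.1 hi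
    omega
  have h1 := hasFDerivAt_iteratedFDeriv_diag i (hf.of_le (by exact_mod_cast hi')) z (w - z)
  have h2 := (h1.comp w ((hasFDerivAt_id w).sub_const z)).const_smul ((1 : ℝ) / ((i + 1)! : ℝ))
  have : ((i ! : ℝ)) ≠ 0 := by positivity
  have h5 : ((1 : ℝ) / (i ! : ℝ)) = (1 / ((i + 1)! : ℝ)) * ((i + 1 : ℕ) : ℝ) := by
    rw [Nat.factorial_succ]
    push_cast
    field_simp
  convert h2 using 1
  · rfl
  · rw [ContinuousLinearMap.comp_id, smul_smul, ← h5]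

/-- Taylor's theorem for a function whose `k`-th derivative is Lipschitz continuous. -/
theorem norm_sub_taylorApprox_le (k : ℕ) :
    ∀ {G : Type u} [NormedAddCommGroup G] [NormedSpace ℝ G] {f : E → G} {L : ℝ},
      ContDiff ℝ (k : ℕ) f →
      (∀ z w, ‖iteratedFDeriv ℝ k f z - iteratedFDeriv ℝ k f w‖ ≤ L * ‖z - w‖) →
      ∀ z w, ‖f w - taylorApprox f k z w‖ ≤ L / ((k + 1)! : ℝ) * ‖w - z‖ ^ (k + 1) := by
  induction k with
  | zero =>
    intro G _ _ f L hf hL z w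
    have h := hL w z
    have h0 : ∀ x, iteratedFDeriv ℝ 0 f x = (continuousMultilinearCurryFin0 ℝ E G).symm (f x) :=
      fun x => rfl
    rw [h0, h0, ← map_sub, LinearIsometryEquiv.norm_map] at h
    simpa [taylorApprox] using h
  | succ k ih =>
    intro G _ _ f L hf hL z w
    have h1 : ContDiff ℝ (k : ℕ) (fderiv ℝ f) := hf.fderiv_right (by norm_cast)
    have hL' : ∀ z w, ‖iteratedFDeriv ℝ k (fderiv ℝ f) z - iteratedFDeriv ℝ k (fderiv ℝ f) w‖
        ≤ L * ‖z - w‖ := by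
      intro z w
      have := hL z w
      rw [iteratedFDeriv_succ_eq_comp_right, iteratedFDeriv_succ_eq_comp_right,
        Function.comp_apply, Function.comp_apply, ← dist_eq_norm, LinearIsometryEquiv.dist_map,
        dist_eq_norm] at this
      exact this
    have hd : ∀ x, HasFDerivAt (fun x => f x - taylorApprox f (k + 1) z x)
        (fderiv ℝ f x - taylorApprox (fderiv ℝ f) k z x) x := fun x =>
      ((hf.differentiable (by norm_cast)) x).hasFDerivAt.sub (hasFDerivAt_taylorApprox hf z x)
    set v := w - z with hv
    -- the remainder along the segment from `z` to `w`
    have hline : ∀ t : ℝ, HasDerivAt (fun t : ℝ => z + t • v) v t := fun t => by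
      simpa using ((hasDerivAt_id t).smul_const v).const_add z
    have hd' : ∀ t : ℝ, HasDerivAt
        (fun t : ℝ => f (z + t • v) - taylorApprox f (k + 1) z (z + t • v))
        ((fderiv ℝ f (z + t • v) - taylorApprox (fderiv ℝ f) k z (z + t • v)) v) t := fun t =>
      HasFDerivAt.comp_hasDerivAt (l := fun x => f x - taylorApprox f (k + 1) z x) t
        (hd (z + t • v)) (hline t)
    have hB : ∀ t : ℝ, HasDerivAt
        (fun t : ℝ => L / ((k + 1 + 1)! : ℝ) * ‖v‖ ^ (k + 1 + 1) * t ^ (k + 1 + 1))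
        (L / ((k + 1)! : ℝ) * ‖v‖ ^ (k + 1 + 1) * t ^ (k + 1)) t := by
      intro t
      have h := (hasDerivAt_pow (k + 1 + 1) t).const_mul
        (L / ((k + 1 + 1)! : ℝ) * ‖v‖ ^ (k + 1 + 1))
      have e : L / ((k + 1)! : ℝ) * ‖v‖ ^ (k + 1 + 1) * t ^ (k + 1) =
          L / ((k + 1 + 1)! : ℝ) * ‖v‖ ^ (k + 1 + 1) *
            (((k + 1 + 1 : ℕ) : ℝ) * t ^ (k + 1 + 1 - 1)) := by
        have : ((k + 1)! : ℝ) ≠ 0 := by positivity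
        rw [Nat.factorial_succ (k + 1), show k + 1 + 1 - 1 = k + 1 by omega]
        push_cast
        field_simp
      rw [e]
      exact h
    have hzero : ∀ i : ℕ, iteratedFDeriv ℝ (i + 1) f z (fun _ => 0) = 0 := fun i =>
      (iteratedFDeriv ℝ (i + 1) f z).map_zero
    have key := image_norm_le_of_norm_deriv_right_le_deriv_boundary (a := 0) (b := 1)
      (f := fun t : ℝ => f (z + t • v) - taylorApprox f (k + 1) z (z + t • v))
      (fun t _ => (hd' t).continuousAt.continuousWithinAt)
      (fun t _ => (hd' t).hasDerivWithinAt)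
      (B := fun t : ℝ => L / ((k + 1 + 1)! : ℝ) * ‖v‖ ^ (k + 1 + 1) * t ^ (k + 1 + 1))
      (by simp [taylorApprox, Finset.sum_range_succ' _ (k + 1), hzero]) hB
      (by
        intro t ht
        have h3 := ih h1 hL' z (z + t • v)
        rw [add_sub_cancel_left, norm_smul, Real.norm_of_nonneg ht.1] at h3
        calc _ ≤ L / ((k + 1)! : ℝ) * (t * ‖v‖) ^ (k + 1) * ‖v‖ :=
              (ContinuousLinearMap.le_opNorm _ _).trans
                (mul_le_mul_of_nonneg_right h3 (norm_nonneg v))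
          _ = _ := by ring)
      (Set.right_mem_Icc.2 zero_le_one)
    simpa [hv] using key

end Taylor

/-! ### Restarted Mirror-Prox -/

section MirrorProx

/-- The minimizer of a proximal step with a linear function is the explicit gradient step. -/
theorem eq_sub_of_isMinOn_prox {E : Type*} [NormedAddCommGroup E] [InnerProductSpace ℝ E]
    {a b z u : E}
    (h : IsMinOn (fun w => inner ℝ a (w - b) + 1 / 2 * ‖w - z‖ ^ 2) Set.univ u) :
    u = z - a := by
  have h1 := h (Set.mem_univ (z - a))
  have e : ∀ w, inner ℝ a (w - b) + 1 / 2 * ‖w - z‖ ^ 2 =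
      1 / 2 * ‖w - (z - a)‖ ^ 2 + (inner ℝ a (z - b) - 1 / 2 * ‖a‖ ^ 2) := by
    intro w
    have e1 : w - (z - a) = (w - z) + a := by abel
    have e2 : w - b = (w - z) + (z - b) := by abel
    rw [e1, e2, inner_add_right, norm_add_sq_real, real_inner_comm a (w - z)]
    ring
  simp only [Set.mem_ofPred_eq, e, sub_self, norm_zero] at h1
  have h2 : ‖u - (z - a)‖ ^ 2 ≤ 0 := by linarith
  have h3 : ‖u - (z - a)‖ = 0 := by
    have := norm_nonneg (u - (z - a))
    nlinarith
  exact sub_eq_zero.1 (norm_eq_zero.1 h3)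

/-- The tangent of the convex function `s ↦ s ^ (-n / 2)` at `s = 1` lies below it, written with
`s = x ^ 2` and without division. -/
theorem pow_mul_tangent_le_one (n : ℕ) {x : ℝ} (hx : 0 ≤ x) :
    x ^ n * (1 + n / 2 - n / 2 * x ^ 2) ≤ 1 := by
  rcases hx.eq_or_lt with rfl | hx
  · rcases Nat.eq_zero_or_pos n with rfl | hn
    · simp
    · simp [hn.ne']
  · have h1 := Real.log_le_sub_one_of_pos (pow_pos hx 2)
    rw [Real.log_pow] at h1
    have h2 : (1 + n / 2 - n / 2 * x ^ 2 : ℝ) ≤ Real.exp (-(n * Real.log x)) := by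
      have h3 := Real.add_one_le_exp (-(n * Real.log x))
      have h4 : (0 : ℝ) ≤ n := Nat.cast_nonneg n
      push_cast at h1
      nlinarith
    have h5 : x ^ n = Real.exp (n * Real.log x) := by
      rw [← Real.log_pow, Real.exp_log (pow_pos hx n)]
    calc _ ≤ x ^ n * Real.exp (-(n * Real.log x)) := by gcongr
      _ = 1 := by rw [h5, ← Real.exp_add]; simp

theorem two_pow_le_factorial {p : ℕ} (hp : 1 ≤ p) : (2 : ℝ) ^ (p - 1) ≤ (p ! : ℝ) := by
  induction p, hp using Nat.le_induction with
  | base => simp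
  | succ p hp ih =>
    obtain ⟨q, rfl⟩ : ∃ q, p = q + 1 := ⟨p - 1, by omega⟩
    rw [Nat.factorial_succ]
    simp only [Nat.add_sub_cancel] at ih ⊢
    push_cast
    rw [pow_succ]
    have : (0 : ℝ) ≤ q := Nat.cast_nonneg q
    have : (0 : ℝ) < 2 ^ q := by positivity
    nlinarith

variable {n m : ℕ}

/-- The energy inequality of one Mirror-Prox step. The bound on the Taylor remainder and the upper
bound on the step size give `‖z' - zh‖ ≤ ‖zh - z‖ / 8`. -/
theorem MirrorProxStep.energy {F : Pair n m → Pair n m} {p : ℕ} {L μ γ : ℝ}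
    {z zh z' zs : Pair n m} (hp : 1 ≤ p)
    (hT : ∀ z w, ‖F w - taylorApprox F (p - 1) z w‖ ≤ 2 * L / (p ! : ℝ) * ‖w - z‖ ^ p)
    (hF : ∀ z, μ * ‖z - zs‖ ^ 2 ≤ inner ℝ (F z) (z - zs))
    (h : MirrorProxStep F p L z γ zh z') :
    2 * μ * (γ * ‖zh - zs‖ ^ 2) + 1 / 4 * ‖zh - z‖ ^ 2 ≤ ‖z - zs‖ ^ 2 - ‖z' - zs‖ ^ 2 := by
  have hz' : z' = z - γ • F zh := eq_sub_of_isMinOn_prox h.argmin_next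
  have hzh : zh = z - γ • taylorApprox F (p - 1) z zh := by
    refine eq_sub_of_isMinOn_prox (b := z) ?_
    have := h.argmin_mid
    simpa only [real_inner_smul_left] using this
  have hpf : (0 : ℝ) < p ! := by positivity
  have hd : ‖z' - zh‖ ≤ 1 / 8 * ‖zh - z‖ := by
    have e : z' - zh = -(γ • (F zh - taylorApprox F (p - 1) z zh)) := by
      calc z' - zh = (z - γ • F zh) - (z - γ • taylorApprox F (p - 1) z zh) := by
            rw [← hz', ← hzh]
        _ = _ := by
            rw [smul_sub]
            abel
    rw [e, norm_neg, norm_smul, Real.norm_of_nonneg h.pos.le]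
    have h1 := mul_le_mul_of_nonneg_left (hT z zh) h.pos.le
    have h2 : γ * (2 * L / (p ! : ℝ) * ‖zh - z‖ ^ p) =
        (16 * L * ‖zh - z‖ ^ (p - 1) * γ) / (p ! : ℝ) * (1 / 8 * ‖zh - z‖) := by
      obtain ⟨q, rfl⟩ : ∃ q, p = q + 1 := ⟨p - 1, by omega⟩
      simp only [Nat.add_sub_cancel]
      field_simp
      ring
    have h3 : (16 * L * ‖zh - z‖ ^ (p - 1) * γ) / (p ! : ℝ) ≤ 1 := by
      rw [div_le_one hpf]
      exact h.upper
    calc _ ≤ _ := h1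
      _ = _ := h2
      _ ≤ 1 * (1 / 8 * ‖zh - z‖) := by gcongr
      _ = _ := one_mul _
  have h1 : γ * inner ℝ (F zh) (zh - zs) = inner ℝ (z - z') (zh - zs) := by
    rw [← real_inner_smul_left]
    congr 1
    rw [hz']
    abel
  have h2 : 2 * inner ℝ (z - z') (zh - zs) =
      ‖z - zs‖ ^ 2 - ‖z' - zs‖ ^ 2 + ‖z' - zh‖ ^ 2 - ‖zh - z‖ ^ 2 := by
    have e1 : z - z' = (z - zs) - (z' - zs) := by abel
    have e2 : z' - zh = (z' - zs) - (zh - zs) := by abel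
    have e3 : zh - z = (zh - zs) - (z - zs) := by abel
    rw [e1, e2, e3, norm_sub_sq_real (z' - zs), norm_sub_sq_real (zh - zs), inner_sub_left,
      real_inner_comm (z - zs) (zh - zs)]
    ring
  have h3 := mul_le_mul_of_nonneg_left (hF zh) h.pos.le
  have h4 : ‖z' - zh‖ ^ 2 ≤ (1 / 8 * ‖zh - z‖) ^ 2 := by gcongr
  nlinarith [sq_nonneg ‖zh - z‖]

/-- The lower bound on the step size makes it large on average. With `ρ` the root mean square bound
on the displacements, the tangent inequality linearizes `‖zh - z‖ ^ (-(p - 1))`. -/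
theorem MirrorProxStep.le_stepSize {F : Pair n m → Pair n m} {p : ℕ} {L γ ρ : ℝ}
    {z zh z' : Pair n m} (hL : 0 < L) (hρ : 0 < ρ) (h : MirrorProxStep F p L z γ zh z') :
    (p ! : ℝ) / (32 * L * ρ ^ (p - 1)) *
      (1 + (p - 1 : ℕ) / 2 - (p - 1 : ℕ) / 2 * (‖zh - z‖ / ρ) ^ 2) ≤ γ := by
  set c : ℝ := 1 + (p - 1 : ℕ) / 2 - (p - 1 : ℕ) / 2 * (‖zh - z‖ / ρ) ^ 2 with hc
  rcases le_or_gt c 0 with h0 | h0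
  · exact (mul_nonpos_of_nonneg_of_nonpos (by positivity) h0).trans h.pos.le
  · have h1 := pow_mul_tangent_le_one (p - 1) (x := ‖zh - z‖ / ρ) (by positivity)
    rw [← hc, div_pow, div_mul_eq_mul_div, div_le_one (by positivity)] at h1
    rw [div_mul_eq_mul_div, div_le_iff₀ (by positivity)]
    calc (p ! : ℝ) * c ≤ (32 * L * ‖zh - z‖ ^ (p - 1) * γ) * c := by
          gcongr
          exact h.lower
      _ = 32 * L * γ * (‖zh - z‖ ^ (p - 1) * c) := by ring
      _ ≤ 32 * L * γ * ρ ^ (p - 1) := by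
          have := h.pos
          gcongr
      _ = _ := by ring

/-- The square of the norm is convex. -/
theorem norm_average_sub_sq_le {E : Type*} [NormedAddCommGroup E] [InnerProductSpace ℝ E]
    {T : ℕ} {γ : ℕ → ℝ} {v : ℕ → E} (zs : E) (hγ : ∀ t < T, 0 < γ t)
    (hΓ : 0 < ∑ t ∈ Finset.range T, γ t) :
    (∑ t ∈ Finset.range T, γ t) *
      ‖(∑ t ∈ Finset.range T, γ t)⁻¹ • ∑ t ∈ Finset.range T, γ t • v t - zs‖ ^ 2 ≤
      ∑ t ∈ Finset.range T, γ t * ‖v t - zs‖ ^ 2 := by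
  set Γ := ∑ t ∈ Finset.range T, γ t with hΓdef
  have e : Γ⁻¹ • ∑ t ∈ Finset.range T, γ t • v t - zs =
      Γ⁻¹ • ∑ t ∈ Finset.range T, γ t • (v t - zs) := by
    simp only [smul_sub, Finset.sum_sub_distrib, ← Finset.sum_smul, ← hΓdef, smul_smul]
    rw [inv_mul_cancel₀ hΓ.ne', one_smul]
  have h1 : ‖∑ t ∈ Finset.range T, γ t • (v t - zs)‖ ≤
      ∑ t ∈ Finset.range T, γ t * ‖v t - zs‖ := by
    refine (norm_sum_le _ _).trans (Finset.sum_le_sum fun t ht => ?_)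
    rw [norm_smul, Real.norm_of_nonneg (hγ t (Finset.mem_range.1 ht)).le]
  have h2 : (∑ t ∈ Finset.range T, γ t * ‖v t - zs‖) ^ 2 ≤
      Γ * ∑ t ∈ Finset.range T, γ t * ‖v t - zs‖ ^ 2 := by
    refine Finset.sum_sq_le_sum_mul_sum_of_sq_le_mul _
      (fun t ht => (hγ t (Finset.mem_range.1 ht)).le) (fun t ht => ?_) (fun t _ => le_of_eq (by ring))
    have := hγ t (Finset.mem_range.1 ht)
    positivity
  rw [e, norm_smul, norm_inv, Real.norm_of_nonneg hΓ.le]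
  have h3 := (pow_le_pow_left₀ (norm_nonneg _) h1 2).trans h2
  calc Γ * (Γ⁻¹ * ‖∑ t ∈ Finset.range T, γ t • (v t - zs)‖) ^ 2
      = Γ⁻¹ * ‖∑ t ∈ Finset.range T, γ t • (v t - zs)‖ ^ 2 := by field_simp
    _ ≤ Γ⁻¹ * (Γ * ∑ t ∈ Finset.range T, γ t * ‖v t - zs‖ ^ 2) := by gcongr
    _ = _ := by field_simp

/-- One restart of Mirror-Prox for a strongly monotone operator halves the distance to its zero. -/
theorem IsMirrorProxOutput.dist_le_half {F : Pair n m → Pair n m} {p T : ℕ} {L μ R : ℝ}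
    {z₁ out zs : Pair n m} (hp : 1 ≤ p) (hL : 0 < L) (hμ : 0 < μ) (hR : 0 < R)
    (hT : ∀ z w, ‖F w - taylorApprox F (p - 1) z w‖ ≤ 2 * L / (p ! : ℝ) * ‖w - z‖ ^ p)
    (hF : ∀ z, μ * ‖z - zs‖ ^ 2 ≤ inner ℝ (F z) (z - zs))
    (hz : ‖z₁ - zs‖ ≤ R) (hT0 : 0 < T)
    (hTR : 64 * L * R ^ (p - 1) / μ ≤ Real.sqrt T ^ (p + 1))
    (h : IsMirrorProxOutput F p L T z₁ out) : ‖out - zs‖ ≤ R / 2 := by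
  obtain ⟨z, zh, γ, hz0, ⟨hstep, hout⟩ | ⟨s, -, -, hs, hout⟩⟩ := h
  · set S := Real.sqrt T with hS
    have hTpos : (0 : ℝ) < T := by exact_mod_cast hT0
    have hSpos : 0 < S := Real.sqrt_pos.2 hTpos
    have hSsq : S ^ 2 = T := Real.sq_sqrt hTpos.le
    -- telescoping the energy inequality
    have hsum : ∀ t ≤ T, 2 * μ * ∑ i ∈ Finset.range t, γ i * ‖zh i - zs‖ ^ 2 +
        1 / 4 * ∑ i ∈ Finset.range t, ‖zh i - z i‖ ^ 2 ≤ ‖z 0 - zs‖ ^ 2 - ‖z t - zs‖ ^ 2 := by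
      intro t ht
      induction t with
      | zero => simp
      | succ t ih =>
        have h1 := ih (by omega)
        have h2 := (hstep t (by omega)).energy hp hT hF
        rw [Finset.sum_range_succ, Finset.sum_range_succ]
        linarith
    have hA := hsum T le_rfl
    rw [hz0] at hA
    have hR2 : ‖z₁ - zs‖ ^ 2 ≤ R ^ 2 := by gcongr
    have hpos : ∀ t < T, 0 < γ t := fun t ht => (hstep t ht).pos
    have hn1 : 0 ≤ ∑ i ∈ Finset.range T, γ i * ‖zh i - zs‖ ^ 2 :=
      Finset.sum_nonneg fun t ht => mul_nonneg (hpos t (Finset.mem_range.1 ht)).le (sq_nonneg _)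
    have hδ : ∑ i ∈ Finset.range T, ‖zh i - z i‖ ^ 2 ≤ 4 * R ^ 2 := by
      have := mul_nonneg hμ.le hn1
      nlinarith [sq_nonneg ‖z T - zs‖]
    have hγsum : 2 * μ * ∑ i ∈ Finset.range T, γ i * ‖zh i - zs‖ ^ 2 ≤ R ^ 2 := by
      have : 0 ≤ ∑ i ∈ Finset.range T, ‖zh i - z i‖ ^ 2 :=
        Finset.sum_nonneg fun t _ => sq_nonneg _
      nlinarith [sq_nonneg ‖z T - zs‖]
    -- the sum of the step sizes, with `ρ ^ 2 = 4 R ^ 2 / T`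
    set ρ := 2 * R / S with hρ
    have hρpos : 0 < ρ := by positivity
    set Γ := ∑ t ∈ Finset.range T, γ t with hΓ
    have hΓ1 : (p ! : ℝ) / (32 * L * ρ ^ (p - 1)) * T ≤ Γ := by
      have h1 : ∑ t ∈ Finset.range T, (p ! : ℝ) / (32 * L * ρ ^ (p - 1)) *
          (1 + (p - 1 : ℕ) / 2 - (p - 1 : ℕ) / 2 * (‖zh t - z t‖ / ρ) ^ 2) ≤ Γ :=
        Finset.sum_le_sum fun t ht => (hstep t (Finset.mem_range.1 ht)).le_stepSize hL hρpos
      refine le_trans ?_ h1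
      rw [← Finset.mul_sum]
      gcongr
      rw [Finset.sum_sub_distrib, ← Finset.mul_sum]
      have h2 : ∑ t ∈ Finset.range T, (‖zh t - z t‖ / ρ) ^ 2 ≤ T := by
        simp only [div_pow]
        rw [← Finset.sum_div, div_le_iff₀ (by positivity), hρ, div_pow, ← hSsq]
        calc _ ≤ _ := hδ
          _ = _ := by field_simp; ring
      simp only [Finset.sum_const, Finset.card_range, nsmul_eq_mul]
      have h3 : (0 : ℝ) ≤ (p - 1 : ℕ) / 2 := by positivity
      nlinarith
    have hΓ2 : 2 ≤ μ * Γ := by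
      have h1 : (p ! : ℝ) / (32 * L * ρ ^ (p - 1)) * T =
          (p ! : ℝ) * S ^ (p + 1) / (32 * L * 2 ^ (p - 1) * R ^ (p - 1)) := by
        obtain ⟨q, rfl⟩ : ∃ q, p = q + 1 := ⟨p - 1, by omega⟩
        simp only [Nat.add_sub_cancel]
        rw [← hSsq, hρ, div_pow, mul_pow, show q + 1 + 1 = q + 2 by ring, pow_add S q 2]
        field_simp
      have h2 : (p ! : ℝ) * S ^ (p + 1) / (32 * L * 2 ^ (p - 1) * R ^ (p - 1)) ≥
          (p ! : ℝ) * (64 * L * R ^ (p - 1) / μ) / (32 * L * 2 ^ (p - 1) * R ^ (p - 1)) := by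
        gcongr
      have h3 : (p ! : ℝ) * (64 * L * R ^ (p - 1) / μ) / (32 * L * 2 ^ (p - 1) * R ^ (p - 1)) =
          2 * ((p ! : ℝ) / 2 ^ (p - 1)) / μ := by
        field_simp
        ring
      have h4 : 1 ≤ (p ! : ℝ) / 2 ^ (p - 1) := by
        rw [one_le_div (by positivity)]
        exact two_pow_le_factorial hp
      have h5 : 2 / μ ≤ Γ := by
        calc 2 / μ = 2 * 1 / μ := by ring
          _ ≤ 2 * ((p ! : ℝ) / 2 ^ (p - 1)) / μ := by gcongr
          _ ≤ Γ := by linarith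
      rwa [div_le_iff₀ hμ, mul_comm] at h5
    have hΓpos : 0 < Γ := by
      by_contra h0
      nlinarith
    have h6 := norm_average_sub_sq_le (v := zh) zs hpos hΓpos
    rw [← hΓ, ← hout] at h6
    have h7 : ‖out - zs‖ ^ 2 ≤ (R / 2) ^ 2 := by
      have h8 := mul_le_mul_of_nonneg_left h6 hμ.le
      nlinarith [mul_nonneg (sub_nonneg.2 hΓ2) (sq_nonneg ‖out - zs‖)]
    exact (sq_le_sq₀ (norm_nonneg _) (by positivity)).1 (h7)
  · have h1 := hF out
    rw [hout, hs, inner_zero_left] at h1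
    have h2 : ‖z s - zs‖ ^ 2 ≤ 0 := by
      by_contra h0
      nlinarith [mul_pos hμ (not_le.1 h0)]
    rw [hout]
    exact (sq_le_sq₀ (norm_nonneg _) (by positivity)).1 ((h2.trans (by positivity)))

end MirrorProx

/-! ### The saddle operator -/

section SaddleOperator

/-- The derivative along a line. -/
theorem HasFDerivAt.hasDerivAt_line {E : Type*} [NormedAddCommGroup E] [NormedSpace ℝ E]
    {h : E → ℝ} {l : E →L[ℝ] ℝ} {w : E} (hd : HasFDerivAt h l w) (v : E) :
    HasDerivAt (fun t : ℝ => h (w + t • v)) (l v) 0 := by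
  have h1 : HasDerivAt (fun t : ℝ => w + t • v) v 0 := by
    simpa using ((hasDerivAt_id (0 : ℝ)).smul_const v).const_add w
  have h2 : HasFDerivAt h l (w + (0 : ℝ) • v) := by simpa using hd
  exact HasFDerivAt.comp_hasDerivAt (l := h) 0 h2 h1

theorem contDiff_smul_sub_const {E : Type*} [NormedAddCommGroup E] [NormedSpace ℝ E] {k : ℕ}
    (μ : ℝ) (z₁ : E) : ContDiff ℝ (k : ℕ) (fun z : E => μ • (z - z₁)) :=
  (contDiff_id.sub contDiff_const).const_smul μ

/-- The derivatives of positive order of an affine map are constant. -/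
theorem iteratedFDeriv_succ_smul_sub_const {E : Type*} [NormedAddCommGroup E] [NormedSpace ℝ E]
    (k : ℕ) (μ : ℝ) (z₁ z w : E) :
    iteratedFDeriv ℝ (k + 1) (fun z : E => μ • (z - z₁)) z =
      iteratedFDeriv ℝ (k + 1) (fun z : E => μ • (z - z₁)) w := by
  have hc : ∀ x, fderiv ℝ (fun z : E => μ • (z - z₁)) x = μ • ContinuousLinearMap.id ℝ E :=
    fun x => (((hasFDerivAt_id x).sub_const z₁).const_smul μ).fderiv
  rw [iteratedFDeriv_succ_eq_comp_right, iteratedFDeriv_succ_eq_comp_right]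
  simp only [Function.comp_apply, hc]
  rcases Nat.eq_zero_or_pos k with rfl | hk
  · rfl
  · rw [iteratedFDeriv_const_of_ne hk.ne']
    rfl

variable {n m : ℕ}

@[simp] theorem mkPair_fst (x : EuclideanSpace ℝ (Fin n)) (y : EuclideanSpace ℝ (Fin m)) :
    (mkPair x y).fst = x := rfl

@[simp] theorem mkPair_snd (x : EuclideanSpace ℝ (Fin n)) (y : EuclideanSpace ℝ (Fin m)) :
    (mkPair x y).snd = y := rfl

theorem pair_ext {z w : Pair n m} (h1 : z.fst = w.fst) (h2 : z.snd = w.snd) : z = w :=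
  WithLp.ofLp_injective 2 (Prod.ext h1 h2)

theorem pair_inner (z w : Pair n m) :
    inner ℝ z w = inner ℝ z.fst w.fst + inner ℝ z.snd w.snd := rfl

theorem pair_norm_sq (z : Pair n m) : ‖z‖ ^ 2 = ‖z.fst‖ ^ 2 + ‖z.snd‖ ^ 2 :=
  WithLp.prod_norm_sq_eq_of_L2 z

/-- The reflection `(x, y) ↦ (x, -y)`. -/
noncomputable def flipSnd : Pair n m →ₗᵢ[ℝ] Pair n m where
  toFun z := mkPair z.fst (-z.snd)
  map_add' z w := pair_ext (by simp) (by simp [add_comm])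
  map_smul' c z := pair_ext (by simp) (by simp)
  norm_map' z := by
    refine (sq_eq_sq₀ (norm_nonneg _) (norm_nonneg _)).1 ?_
    rw [pair_norm_sq, pair_norm_sq]
    simp

@[simp] theorem flipSnd_fst (z : Pair n m) : (flipSnd z).fst = z.fst := rfl

@[simp] theorem flipSnd_snd (z : Pair n m) : (flipSnd z).snd = -z.snd := rfl

theorem inner_flipSnd (z w : Pair n m) : inner ℝ (flipSnd z) w = inner ℝ z (flipSnd w) := by
  simp

/-- The isometry that turns the derivative of `g` into the saddle operator of `g`. -/
noncomputable def saddleIso : (Pair n m →L[ℝ] ℝ) →ₗᵢ[ℝ] Pair n m where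
  toFun l := flipSnd ((InnerProductSpace.toDual ℝ (Pair n m)).symm l)
  map_add' l l' := by simp
  map_smul' c l := by simp
  norm_map' l := by simp

theorem saddleOp_eq (g : Pair n m → ℝ) (z : Pair n m) : saddleOp g z = saddleIso (fderiv ℝ g z) :=
  rfl

theorem saddleOp_eq_comp (g : Pair n m → ℝ) :
    saddleOp g = saddleIso.toContinuousLinearMap ∘ fderiv ℝ g := rfl

theorem norm_saddleOp (g : Pair n m → ℝ) (z : Pair n m) : ‖saddleOp g z‖ = ‖∇ g z‖ :=
  flipSnd.norm_map _

theorem inner_saddleIso (l : Pair n m →L[ℝ] ℝ) (v : Pair n m) :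
    inner ℝ (saddleIso l) v = l (flipSnd v) := by
  change inner ℝ (flipSnd ((InnerProductSpace.toDual ℝ (Pair n m)).symm l)) v = _
  rw [inner_flipSnd, InnerProductSpace.toDual_symm_apply]

/-- At a saddle point the derivative vanishes. -/
theorem IsSaddle.hasFDerivAt_eq_zero {h : Pair n m → ℝ} {l : Pair n m →L[ℝ] ℝ} {w : Pair n m}
    (hs : IsSaddle h w) (hd : HasFDerivAt h l w) : l = 0 := by
  have hx : ∀ u, l (mkPair u 0) = 0 := by
    intro u
    refine IsLocalMin.hasDerivAt_eq_zero (Filter.Eventually.of_forall fun t => ?_)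
      (hd.hasDerivAt_line (mkPair u 0))
    have e : w + t • mkPair u 0 = mkPair (w.fst + t • u) w.snd := pair_ext (by simp) (by simp)
    rw [zero_smul, add_zero, e]
    exact hs (w.fst + t • u) (Set.mem_univ _) w.snd (Set.mem_univ _)
  have hy : ∀ u, l (mkPair 0 u) = 0 := by
    intro u
    refine IsLocalMax.hasDerivAt_eq_zero (Filter.Eventually.of_forall fun t => ?_)
      (hd.hasDerivAt_line (mkPair 0 u))
    have e : w + t • mkPair 0 u = mkPair w.fst (w.snd + t • u) := pair_ext (by simp) (by simp)
    rw [zero_smul, add_zero, e]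
    exact hs w.fst (Set.mem_univ _) (w.snd + t • u) (Set.mem_univ _)
  ext v
  have e : v = mkPair v.fst 0 + mkPair 0 v.snd := pair_ext (by simp) (by simp)
  rw [e, map_add, hx, hy]
  simp

/-- The gradient inequality along a line on which the function is convex. -/
theorem add_fderiv_le_of_convexOn_line {E : Type*} [NormedAddCommGroup E] [NormedSpace ℝ E]
    {f : E → ℝ} {z v : E} (hf : DifferentiableAt ℝ f z)
    (hc : ConvexOn ℝ Set.univ (fun t : ℝ => f (z + t • v))) :
    f z + fderiv ℝ f z v ≤ f (z + v) := by
  have h3 := hc.le_slope_of_hasDerivAt (Set.mem_univ 0) (Set.mem_univ 1) one_pos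
    (hf.hasFDerivAt.hasDerivAt_line v)
  rw [slope_def_field] at h3
  simp only [zero_smul, add_zero, one_smul, sub_zero, div_one] at h3
  linarith

theorem ConvexConcave.add_fderiv_fst_le {g : Pair n m → ℝ} (hg : ConvexConcave g)
    (hd : Differentiable ℝ g) (z : Pair n m) (u : EuclideanSpace ℝ (Fin n)) :
    g z + fderiv ℝ g z (mkPair u 0) ≤ g (z + mkPair u 0) := by
  refine add_fderiv_le_of_convexOn_line (hd z) ?_
  have e : (fun t : ℝ => g (z + t • mkPair u 0)) =
      (fun x => g (mkPair x z.snd)) ∘ AffineMap.lineMap z.fst (z.fst + u) :=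
    funext fun t => congrArg g
      (pair_ext (by simp [AffineMap.lineMap_apply, add_comm]) (by simp))
  rw [e]
  simpa using (hg.1 z.snd).comp_affineMap (AffineMap.lineMap z.fst (z.fst + u))

theorem ConvexConcave.le_add_fderiv_snd {g : Pair n m → ℝ} (hg : ConvexConcave g)
    (hd : Differentiable ℝ g) (z : Pair n m) (u : EuclideanSpace ℝ (Fin m)) :
    g (z + mkPair 0 u) ≤ g z + fderiv ℝ g z (mkPair 0 u) := by
  have e : (fun t : ℝ => -g (z + t • mkPair 0 u)) =
      (-fun y => g (mkPair z.fst y)) ∘ AffineMap.lineMap z.snd (z.snd + u) :=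
    funext fun t => congrArg (fun w => -g w)
      (pair_ext (by simp) (by simp [AffineMap.lineMap_apply, add_comm]))
  have hc : ConvexOn ℝ Set.univ (fun t : ℝ => -g (z + t • mkPair 0 u)) := by
    rw [e]
    simpa using (hg.2 z.fst).neg.comp_affineMap (AffineMap.lineMap z.snd (z.snd + u))
  have h := add_fderiv_le_of_convexOn_line (f := fun w => -g w) (z := z) (v := mkPair 0 u)
    (hd z).neg hc
  rw [fderiv_fun_neg] at h
  simp only [neg_apply] at h
  linarith

/-- The saddle operator of a convex-concave function is monotone: the sum of the four gradient
inequalities between the corners of a rectangle. -/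
theorem ConvexConcave.monotone_saddleOp {g : Pair n m → ℝ} (hg : ConvexConcave g)
    (hd : Differentiable ℝ g) (z w : Pair n m) :
    0 ≤ inner ℝ (saddleOp g z - saddleOp g w) (z - w) := by
  set a := (w - z).fst
  set b := (w - z).snd
  have ha' : (z - w).fst = -a := by simp [a]
  have hb' : (z - w).snd = -b := by simp [b]
  have e1 : z + mkPair a 0 = w + mkPair 0 (-b) := pair_ext (by simp [a]) (by simp [b])
  have e2 : z + mkPair 0 b = w + mkPair (-a) 0 := pair_ext (by simp [a]) (by simp [b])
  have h1 := hg.add_fderiv_fst_le hd z a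
  have h2 := hg.le_add_fderiv_snd hd z b
  have h3 := hg.add_fderiv_fst_le hd w (-a)
  have h4 := hg.le_add_fderiv_snd hd w (-b)
  rw [e1] at h1
  rw [e2] at h2
  have f1 : flipSnd (z - w) = mkPair 0 b - mkPair a 0 :=
    pair_ext (by simp [a]) (by simp [b, neg_add_eq_sub])
  have f2 : flipSnd (z - w) = mkPair (-a) 0 - mkPair 0 (-b) :=
    pair_ext (by simp [a]) (by simp [b, neg_add_eq_sub])
  rw [inner_sub_left, saddleOp_eq, saddleOp_eq, inner_saddleIso, inner_saddleIso]
  nth_rewrite 1 [f1]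
  rw [f2, map_sub, map_sub]
  linarith

/-! ### Norm powers and saddle points of regularized models -/

/-- The saddle operator of `(‖x‖ ^ (q + 1) - ‖y‖ ^ (q + 1)) / (q + 1)`. -/
noncomputable def normPowOp (q : ℕ) (h : Pair n m) : Pair n m :=
  mkPair (‖h.fst‖ ^ (q - 1) • h.fst) (‖h.snd‖ ^ (q - 1) • h.snd)

theorem hasFDerivAt_norm_pow {E : Type*} [NormedAddCommGroup E] [InnerProductSpace ℝ E] {q : ℕ}
    (hq : 1 ≤ q) (x : E) :
    HasFDerivAt (fun x : E => ‖x‖ ^ (q + 1)) (((q + 1 : ℝ) * ‖x‖ ^ (q - 1)) • innerSL ℝ x) x := by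
  have h := hasFDerivAt_norm_rpow x (p := ((q + 1 : ℕ) : ℝ)) (by exact_mod_cast (by omega))
  have e : ((q + 1 : ℕ) : ℝ) - 2 = ((q - 1 : ℕ) : ℝ) := by
    push_cast [hq]
    ring
  simp only [e, Real.rpow_natCast] at h
  simpa using h

theorem exists_hasFDerivAt_normPow {q : ℕ} (hq : 1 ≤ q) (c : ℝ) (z w : Pair n m) :
    ∃ l : Pair n m →L[ℝ] ℝ, HasFDerivAt (fun w : Pair n m =>
      c / (q + 1) * ‖w.fst - z.fst‖ ^ (q + 1) - c / (q + 1) * ‖w.snd - z.snd‖ ^ (q + 1)) l w ∧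
      saddleIso l = c • normPowOp q (w - z) := by
  have h1 : HasFDerivAt (fun w : Pair n m => w.fst - z.fst)
      (WithLp.fstL 2 ℝ (EuclideanSpace ℝ (Fin n)) (EuclideanSpace ℝ (Fin m))) w :=
    (ContinuousLinearMap.hasFDerivAt
      (WithLp.fstL 2 ℝ (EuclideanSpace ℝ (Fin n)) (EuclideanSpace ℝ (Fin m)))).sub_const _
  have h2 : HasFDerivAt (fun w : Pair n m => w.snd - z.snd)
      (WithLp.sndL 2 ℝ (EuclideanSpace ℝ (Fin n)) (EuclideanSpace ℝ (Fin m))) w :=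
    (ContinuousLinearMap.hasFDerivAt
      (WithLp.sndL 2 ℝ (EuclideanSpace ℝ (Fin n)) (EuclideanSpace ℝ (Fin m)))).sub_const _
  have h3 := ((hasFDerivAt_norm_pow hq (w.fst - z.fst)).comp w h1).const_mul (c / (q + 1))
  have h4 := ((hasFDerivAt_norm_pow hq (w.snd - z.snd)).comp w h2).const_mul (c / (q + 1))
  refine ⟨_, h3.sub h4, ?_⟩
  refine ext_inner_right ℝ fun v => ?_
  rw [inner_saddleIso, inner_smul_left, pair_inner]
  have hq0 : (q : ℝ) + 1 ≠ 0 := by positivity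
  simp only [normPowOp, mkPair_fst, mkPair_snd, real_inner_smul_left]
  simp [inner_sub_left]
  field_simp
  ring

theorem taylorApprox_saddleOp {k : ℕ} {f : Pair n m → ℝ} (hf : ContDiff ℝ (k + 1 : ℕ) f)
    (z w : Pair n m) :
    taylorApprox (saddleOp f) k z w = saddleIso (taylorApprox (fderiv ℝ f) k z w) := by
  have h1 : ContDiff ℝ (k : ℕ) (fderiv ℝ f) := hf.fderiv_right (by norm_cast)
  unfold taylorApprox
  rw [map_sum]
  refine Finset.sum_congr rfl fun i hi => ?_
  have hi' : i ≤ k := by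
    have := Finset.mem_range.1 hi
    omega
  rw [map_smul, saddleOp_eq_comp, ContinuousLinearMap.iteratedFDeriv_comp_left _
    h1.contDiffAt (by exact_mod_cast hi')]
  rfl

/-- The first order condition for a saddle point of a regularized Taylor model. -/
theorem taylorApprox_add_normPowOp_eq_zero {p : ℕ} (hp : 1 ≤ p) {c : ℝ} {f : Pair n m → ℝ}
    (hf : ContDiff ℝ (p : ℕ) f) {z w : Pair n m}
    (hs : IsSaddle (fun w => taylorApprox f p z w + c / (p + 1) * ‖w.fst - z.fst‖ ^ (p + 1) -
      c / (p + 1) * ‖w.snd - z.snd‖ ^ (p + 1)) w) :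
    taylorApprox (saddleOp f) (p - 1) z w + c • normPowOp p (w - z) = 0 := by
  obtain ⟨k, rfl⟩ : ∃ k, p = k + 1 := ⟨p - 1, by omega⟩
  obtain ⟨l, hl, hl'⟩ := exists_hasFDerivAt_normPow hp c z w
  have h1 := (hasFDerivAt_taylorApprox hf z w).add hl
  have h2 : taylorApprox (fderiv ℝ f) k z w + l = 0 := by
    refine hs.hasFDerivAt_eq_zero ?_
    have e : (fun w => taylorApprox f (k + 1) z w +
        c / ((k + 1 : ℕ) + 1) * ‖w.fst - z.fst‖ ^ (k + 1 + 1) -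
        c / ((k + 1 : ℕ) + 1) * ‖w.snd - z.snd‖ ^ (k + 1 + 1)) =
        taylorApprox f (k + 1) z + fun w =>
          c / ((k + 1 : ℕ) + 1) * ‖w.fst - z.fst‖ ^ (k + 1 + 1) -
          c / ((k + 1 : ℕ) + 1) * ‖w.snd - z.snd‖ ^ (k + 1 + 1) :=
      funext fun w => add_sub_assoc _ _ _
    rw [e]
    exact h1
  rw [Nat.add_sub_cancel, taylorApprox_saddleOp hf, ← hl', ← map_add, h2, map_zero]

theorem normPowOp_one (h : Pair n m) : normPowOp 1 h = h := pair_ext (by simp [normPowOp])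
  (by simp [normPowOp])

theorem contDiff_regularized {k : ℕ} {g : Pair n m → ℝ} (hg : ContDiff ℝ (k : ℕ) g) (μ : ℝ)
    (z₁ : Pair n m) : ContDiff ℝ (k : ℕ) (regularized g μ z₁) := by
  have h1 : ContDiff ℝ (k : ℕ) (fun w : Pair n m => w.fst - z₁.fst) :=
    (WithLp.fstL 2 ℝ (EuclideanSpace ℝ (Fin n)) (EuclideanSpace ℝ (Fin m))).contDiff.sub
      contDiff_const
  have h2 : ContDiff ℝ (k : ℕ) (fun w : Pair n m => w.snd - z₁.snd) :=
    (WithLp.sndL 2 ℝ (EuclideanSpace ℝ (Fin n)) (EuclideanSpace ℝ (Fin m))).contDiff.sub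
      contDiff_const
  exact hg.add (contDiff_const.mul ((h1.norm_sq ℝ).sub (h2.norm_sq ℝ)))

theorem fderiv_add_hasFDerivAt {E : Type*} [NormedAddCommGroup E] [NormedSpace ℝ E] {g r : E → ℝ}
    {l : E →L[ℝ] ℝ} {z : E} (hg : DifferentiableAt ℝ g z) (hr : HasFDerivAt r l z) :
    fderiv ℝ (g + r) z = fderiv ℝ g z + l :=
  (hg.hasFDerivAt.add hr).fderiv

theorem saddleOp_regularized {g : Pair n m → ℝ} (hg : Differentiable ℝ g) (μ : ℝ)
    (z₁ z : Pair n m) : saddleOp (regularized g μ z₁) z = saddleOp g z + μ • (z - z₁) := by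
  obtain ⟨l, hl, hl'⟩ := exists_hasFDerivAt_normPow le_rfl μ z₁ z
  have e : regularized g μ z₁ = g + fun w =>
      μ / ((1 : ℕ) + 1) * ‖w.fst - z₁.fst‖ ^ (1 + 1) -
      μ / ((1 : ℕ) + 1) * ‖w.snd - z₁.snd‖ ^ (1 + 1) := by
    funext w
    simp only [regularized, Pi.add_apply]
    norm_num
    ring
  rw [saddleOp_eq, e, fderiv_add_hasFDerivAt (hg z) hl, map_add, hl', normPowOp_one]
  rfl

/-! ### Taylor remainders of the saddle operator -/

theorem norm_iteratedFDeriv_saddleOp_sub_le {k : ℕ} {f : Pair n m → ℝ} {L : ℝ}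
    (hf : ContDiff ℝ (k + 1 : ℕ) f) (hL : LipschitzDeriv (k + 1) L f) (z w : Pair n m) :
    ‖iteratedFDeriv ℝ k (saddleOp f) z - iteratedFDeriv ℝ k (saddleOp f) w‖ ≤ L * ‖z - w‖ := by
  have h1 : ContDiff ℝ (k : ℕ) (fderiv ℝ f) := hf.fderiv_right (by norm_cast)
  have h2 := hL z w
  rw [iteratedFDeriv_succ_eq_comp_right, iteratedFDeriv_succ_eq_comp_right,
    Function.comp_apply, Function.comp_apply, ← dist_eq_norm, LinearIsometryEquiv.dist_map,
    dist_eq_norm] at h2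
  rw [saddleOp_eq_comp, ContinuousLinearMap.iteratedFDeriv_comp_left _ h1.contDiffAt le_rfl,
    ContinuousLinearMap.iteratedFDeriv_comp_left _ h1.contDiffAt le_rfl]
  refine le_trans (le_of_eq ?_) h2
  rw [← saddleIso.norm_compContinuousMultilinearMap]
  congr 1
  ext v
  simp

theorem contDiff_saddleOp {k : ℕ} {f : Pair n m → ℝ} (hf : ContDiff ℝ (k + 1 : ℕ) f) :
    ContDiff ℝ (k : ℕ) (saddleOp f) := by
  rw [saddleOp_eq_comp]
  exact (ContinuousLinearMap.contDiff _).comp (hf.fderiv_right (by norm_cast))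

/-- The Lipschitz constant of the operator grows by `μ` with the regularization. -/
theorem norm_saddleOp_regularized_sub_le {g : Pair n m → ℝ} {L μ : ℝ} (hμ : 0 ≤ μ)
    (hg : ContDiff ℝ 1 g) (hL : LipschitzDeriv 1 L g) (z₁ z w : Pair n m) :
    ‖saddleOp (regularized g μ z₁) z - saddleOp (regularized g μ z₁) w‖ ≤ (L + μ) * ‖z - w‖ := by
  have hd : Differentiable ℝ g := hg.differentiable one_ne_zero
  have h := norm_iteratedFDeriv_saddleOp_sub_le (k := 0) hg hL z w
  have h0 : ∀ x, iteratedFDeriv ℝ 0 (saddleOp g) x =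
      (continuousMultilinearCurryFin0 ℝ (Pair n m) (Pair n m)).symm (saddleOp g x) := fun x => rfl
  rw [h0, h0, ← map_sub, LinearIsometryEquiv.norm_map] at h
  have e : saddleOp (regularized g μ z₁) z - saddleOp (regularized g μ z₁) w =
      (saddleOp g z - saddleOp g w) + μ • (z - w) := by
    rw [saddleOp_regularized hd, saddleOp_regularized hd, smul_sub, smul_sub, smul_sub]
    abel
  rw [e, add_mul]
  refine (norm_add_le _ _).trans (add_le_add h ?_)
  rw [norm_smul, Real.norm_of_nonneg hμ]

/-- The derivatives of order at least one of the operator are not affected by the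
regularization, up to constants. -/
theorem norm_iteratedFDeriv_saddleOp_regularized_sub_le {k : ℕ} {g : Pair n m → ℝ} {L : ℝ}
    (μ : ℝ) (hg : ContDiff ℝ (k + 2 : ℕ) g) (hL : LipschitzDeriv (k + 2) L g)
    (z₁ z w : Pair n m) :
    ‖iteratedFDeriv ℝ (k + 1) (saddleOp (regularized g μ z₁)) z -
      iteratedFDeriv ℝ (k + 1) (saddleOp (regularized g μ z₁)) w‖ ≤ L * ‖z - w‖ := by
  have hd : Differentiable ℝ g := hg.differentiable (by norm_cast)
  have hF : ContDiff ℝ (k + 1 : ℕ) (saddleOp g) := contDiff_saddleOp hg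
  have e : saddleOp (regularized g μ z₁) = saddleOp g + fun z => μ • (z - z₁) :=
    funext fun z => saddleOp_regularized hd μ z₁ z
  have h0 := iteratedFDeriv_succ_smul_sub_const k μ z₁ z w
  rw [e, iteratedFDeriv_add hF (contDiff_smul_sub_const μ z₁)]
  simp only [Pi.add_apply, h0, add_sub_add_right_eq_sub]
  exact norm_iteratedFDeriv_saddleOp_sub_le hg hL z w

end SaddleOperator

/-! ### Strongly monotone operators -/

section StronglyMonotone

variable {E : Type*} [NormedAddCommGroup E] [InnerProductSpace ℝ E]

/-- A strongly monotone Lipschitz operator has a zero: a short gradient step is a contraction. -/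
theorem exists_zero_of_stronglyMonotone [CompleteSpace E] {F : E → E} {μ L : ℝ} (hμ : 0 < μ)
    (hm : ∀ z w, μ * ‖z - w‖ ^ 2 ≤ inner ℝ (F z - F w) (z - w))
    (hL : ∀ z w, ‖F z - F w‖ ≤ L * ‖z - w‖) : ∃ z, F z = 0 := by
  set η := μ / (L ^ 2 + μ ^ 2) with hη
  have hηpos : 0 < η := by positivity
  have hημ : η * μ ≤ 1 := by
    rw [hη, div_mul_eq_mul_div, div_le_one (by positivity)]
    nlinarith [sq_nonneg L]
  have hη2 : η ^ 2 * L ^ 2 ≤ η * μ := by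
    have h1 : η * (L ^ 2 + μ ^ 2) = μ := by
      rw [hη]
      field_simp
    have h2 : η ^ 2 * L ^ 2 ≤ η * (η * (L ^ 2 + μ ^ 2)) := by
      nlinarith [sq_nonneg (η * μ)]
    rwa [h1] at h2
  have hstep : ∀ z w, dist (z - η • F z) (w - η • F w) ≤ Real.sqrt (1 - η * μ) * dist z w := by
    intro z w
    rw [dist_eq_norm, dist_eq_norm]
    have h1 : ‖z - η • F z - (w - η • F w)‖ ^ 2 ≤ (1 - η * μ) * ‖z - w‖ ^ 2 := by
      have e : z - η • F z - (w - η • F w) = (z - w) - η • (F z - F w) := by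
        rw [smul_sub]
        abel
      rw [e, norm_sub_sq_real, real_inner_smul_right, norm_smul, Real.norm_of_nonneg hηpos.le,
        real_inner_comm, mul_pow]
      have h2 := mul_le_mul_of_nonneg_left (hm z w) hηpos.le
      have h3 : ‖F z - F w‖ ^ 2 ≤ L ^ 2 * ‖z - w‖ ^ 2 := by
        rw [← mul_pow]
        exact pow_le_pow_left₀ (norm_nonneg _) (hL z w) 2
      have h4 := mul_le_mul_of_nonneg_left h3 (sq_nonneg η)
      have h5 := mul_le_mul_of_nonneg_right hη2 (sq_nonneg ‖z - w‖)
      nlinarith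
    refine (sq_le_sq₀ (norm_nonneg _) (by positivity)).1 ?_
    rwa [mul_pow, Real.sq_sqrt (by linarith)]
  have hK : Real.sqrt (1 - η * μ) < 1 := by
    rw [Real.sqrt_lt' one_pos]
    nlinarith [mul_pos hηpos hμ]
  have hc : ContractingWith (Real.sqrt (1 - η * μ)).toNNReal (fun z => z - η • F z) := by
    refine ⟨Real.toNNReal_lt_one.2 hK, LipschitzWith.of_dist_le_mul fun z w => ?_⟩
    rw [Real.coe_toNNReal _ (Real.sqrt_nonneg _)]
    exact hstep z w
  have hfix := hc.fixedPoint_isFixedPt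
  refine ⟨hc.fixedPoint, ?_⟩
  have h1 : η • F hc.fixedPoint = 0 := sub_eq_self.1 hfix
  exact (smul_eq_zero.1 h1).resolve_left hηpos.ne'

theorem mul_norm_sub_le_of_stronglyMonotone {F : E → E} {μ : ℝ} {z w : E}
    (hm : μ * ‖z - w‖ ^ 2 ≤ inner ℝ (F z - F w) (z - w)) :
    μ * ‖z - w‖ ≤ ‖F z - F w‖ := by
  rcases (norm_nonneg (z - w)).eq_or_lt with h0 | h0
  · rw [← h0, mul_zero]
    exact norm_nonneg _
  · have h1 := real_inner_le_norm (F z - F w) (z - w)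
    have h2 : μ * ‖z - w‖ * ‖z - w‖ ≤ ‖F z - F w‖ * ‖z - w‖ := by nlinarith
    exact le_of_mul_le_mul_right h2 h0

/-- The derivative of a strongly monotone operator is strongly positive. -/
theorem mul_norm_sq_le_inner_fderiv {F : E → E} {μ : ℝ}
    (hm : ∀ z w, μ * ‖z - w‖ ^ 2 ≤ inner ℝ (F z - F w) (z - w)) {z : E}
    (hd : DifferentiableAt ℝ F z) (d : E) : μ * ‖d‖ ^ 2 ≤ inner ℝ (fderiv ℝ F z d) d := by
  have h1 : HasDerivAt (fun t : ℝ => z + t • d) d 0 := by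
    simpa using ((hasDerivAt_id (0 : ℝ)).smul_const d).const_add z
  have h2 : HasFDerivAt F (fderiv ℝ F z) (z + (0 : ℝ) • d) := by simpa using hd.hasFDerivAt
  have h3 : HasDerivAt (fun t : ℝ => F (z + t • d)) (fderiv ℝ F z d) 0 :=
    HasFDerivAt.comp_hasDerivAt (l := F) 0 h2 h1
  have h4 : HasDerivAt (fun t : ℝ => inner ℝ (F (z + t • d)) d - t * (μ * ‖d‖ ^ 2))
      (inner ℝ (fderiv ℝ F z d) d - μ * ‖d‖ ^ 2) 0 := by
    have h5 := h3.inner ℝ (hasDerivAt_const (0 : ℝ) d)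
    have h6 := (hasDerivAt_id (0 : ℝ)).mul_const (μ * ‖d‖ ^ 2)
    simp only [inner_zero_right, zero_add, one_mul, id] at h5 h6
    exact h5.sub h6
  have hmono : Monotone (fun t : ℝ => inner ℝ (F (z + t • d)) d - t * (μ * ‖d‖ ^ 2)) := by
    intro s t hst
    rcases hst.eq_or_lt with rfl | hlt
    · exact le_rfl
    · have h7 := hm (z + t • d) (z + s • d)
      have e : z + t • d - (z + s • d) = (t - s) • d := by
        rw [sub_smul]
        abel
      rw [e, norm_smul, Real.norm_of_nonneg (by linarith), real_inner_smul_right,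
        inner_sub_left] at h7
      have h8 : (t - s) * ((t - s) * (μ * ‖d‖ ^ 2)) ≤
          (t - s) * (inner ℝ (F (z + t • d)) d - inner ℝ (F (z + s • d)) d) := by
        nlinarith
      have h9 := le_of_mul_le_mul_left h8 (by linarith)
      simp only
      linarith
  have h10 := hmono.deriv_nonneg (x := 0)
  rw [h4.deriv] at h10
  linarith

theorem taylorApprox_one {G : Type*} [NormedAddCommGroup G] [NormedSpace ℝ G] (F : E → G)
    (z w : E) : taylorApprox F 1 z w = F z + fderiv ℝ F z (w - z) := by
  simp [taylorApprox, Finset.sum_range_succ]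

end StronglyMonotone

section Regularized

variable {n m : ℕ}

theorem stronglyMonotone_regularized {g : Pair n m → ℝ} (hg : ConvexConcave g)
    (hd : Differentiable ℝ g) (μ : ℝ) (z₁ z w : Pair n m) :
    μ * ‖z - w‖ ^ 2 ≤ inner ℝ (saddleOp (regularized g μ z₁) z -
      saddleOp (regularized g μ z₁) w) (z - w) := by
  have e : saddleOp (regularized g μ z₁) z - saddleOp (regularized g μ z₁) w =
      (saddleOp g z - saddleOp g w) + μ • (z - w) := by
    rw [saddleOp_regularized hd, saddleOp_regularized hd, smul_sub, smul_sub, smul_sub]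
    abel
  rw [e, inner_add_left, real_inner_smul_left, real_inner_self_eq_norm_sq]
  linarith [hg.monotone_saddleOp hd z w]

theorem IsSaddle.saddleOp_eq_zero {g : Pair n m → ℝ} {zs : Pair n m} (hs : IsSaddle g zs)
    (hd : Differentiable ℝ g) : saddleOp g zs = 0 := by
  rw [saddleOp_eq, hs.hasFDerivAt_eq_zero (hd zs).hasFDerivAt, map_zero]

/-- The saddle point of the regularized problem is at least as close to the center of the
regularization as any saddle point of the original problem. -/
theorem norm_sub_le_of_saddleOp_regularized_eq_zero {g : Pair n m → ℝ} (hg : ConvexConcave g)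
    (hd : Differentiable ℝ g) {μ : ℝ} (hμ : 0 < μ) {z₁ zs zr : Pair n m} (hs : IsSaddle g zs)
    (hr : saddleOp (regularized g μ z₁) zr = 0) : ‖z₁ - zr‖ ≤ ‖z₁ - zs‖ := by
  have h1 := hg.monotone_saddleOp hd zr zs
  rw [hs.saddleOp_eq_zero hd, sub_zero] at h1
  rw [saddleOp_regularized hd] at hr
  rw [eq_neg_of_add_eq_zero_left hr, ← smul_neg, neg_sub, real_inner_smul_left] at h1
  have h2 : 0 ≤ inner ℝ (z₁ - zr) (zr - zs) := nonneg_of_mul_nonneg_right h1 hμ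
  have h3 : ‖z₁ - zs‖ ^ 2 = ‖z₁ - zr‖ ^ 2 + 2 * inner ℝ (z₁ - zr) (zr - zs) + ‖zr - zs‖ ^ 2 := by
    rw [← norm_add_sq_real]
    congr 2
    abel
  refine (sq_le_sq₀ (norm_nonneg _) (norm_nonneg _)).1 ?_
  nlinarith [sq_nonneg ‖zr - zs‖]

theorem norm_saddleOp_regularized_sub_taylorApprox_le_of_two_le {p : ℕ} (hp : 2 ≤ p)
    {g : Pair n m → ℝ} {L : ℝ} (μ : ℝ) (hg : ContDiff ℝ (p : ℕ) g) (hLip : LipschitzDeriv p L g)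
    (z₁ z w : Pair n m) :
    ‖saddleOp (regularized g μ z₁) w - taylorApprox (saddleOp (regularized g μ z₁)) (p - 1) z w‖ ≤
      L / (p ! : ℝ) * ‖w - z‖ ^ p := by
  obtain ⟨k, rfl⟩ : ∃ k, p = k + 2 := ⟨p - 2, by omega⟩
  exact norm_sub_taylorApprox_le (k + 1) (contDiff_saddleOp (contDiff_regularized hg μ z₁))
    (norm_iteratedFDeriv_saddleOp_regularized_sub_le μ hg hLip z₁) z w

/-- The Taylor remainder of order `p - 1` for all `p`. For `p = 1` the regularization doubles the
constant at most. -/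
theorem norm_saddleOp_regularized_sub_taylorApprox_le {p : ℕ} (hp : 1 ≤ p) {g : Pair n m → ℝ}
    {L μ : ℝ} (hL : 0 ≤ L) (hμ : 0 ≤ μ) (hμL : p = 1 → μ ≤ L) (hg : ContDiff ℝ (p : ℕ) g)
    (hLip : LipschitzDeriv p L g) (z₁ z w : Pair n m) :
    ‖saddleOp (regularized g μ z₁) w - taylorApprox (saddleOp (regularized g μ z₁)) (p - 1) z w‖ ≤
      2 * L / (p ! : ℝ) * ‖w - z‖ ^ p := by
  rcases hp.eq_or_lt with rfl | hp
  · have h := norm_saddleOp_regularized_sub_le hμ hg hLip z₁ w z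
    have hμL' := hμL rfl
    simp only [taylorApprox, zero_add, Nat.sub_self, Finset.range_one, Finset.sum_singleton,
      Nat.factorial_zero, Nat.cast_one, div_one, one_smul, iteratedFDeriv_zero_apply,
      Nat.factorial_one, pow_one]
    refine h.trans ?_
    gcongr
    linarith
  · refine (norm_saddleOp_regularized_sub_taylorApprox_le_of_two_le hp μ hg hLip z₁ z w).trans ?_
    gcongr
    linarith

end Regularized

/-! ### The cubic-regularized Newton method -/

section CubicNewton

variable {n m : ℕ}

theorem pair_norm_fst_le (z : Pair n m) : ‖z.fst‖ ≤ ‖z‖ := by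
  refine (sq_le_sq₀ (norm_nonneg _) (norm_nonneg _)).1 ?_
  nlinarith [pair_norm_sq z, sq_nonneg ‖z.snd‖]

theorem pair_norm_snd_le (z : Pair n m) : ‖z.snd‖ ≤ ‖z‖ := by
  refine (sq_le_sq₀ (norm_nonneg _) (norm_nonneg _)).1 ?_
  nlinarith [pair_norm_sq z, sq_nonneg ‖z.fst‖]

theorem norm_normPowOp_le {q : ℕ} (hq : 1 ≤ q) (h : Pair n m) : ‖normPowOp q h‖ ≤ ‖h‖ ^ q := by
  obtain ⟨r, rfl⟩ : ∃ r, q = r + 1 := ⟨q - 1, by omega⟩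
  refine (sq_le_sq₀ (norm_nonneg _) (by positivity)).1 ?_
  rw [pair_norm_sq]
  simp only [normPowOp, mkPair_fst, mkPair_snd, Nat.add_sub_cancel, norm_smul, norm_pow, norm_norm]
  have h1 : ‖h.fst‖ ^ r ≤ ‖h‖ ^ r := pow_le_pow_left₀ (norm_nonneg _) (pair_norm_fst_le h) r
  have h2 : ‖h.snd‖ ^ r ≤ ‖h‖ ^ r := pow_le_pow_left₀ (norm_nonneg _) (pair_norm_snd_le h) r
  calc (‖h.fst‖ ^ r * ‖h.fst‖) ^ 2 + (‖h.snd‖ ^ r * ‖h.snd‖) ^ 2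
      ≤ (‖h‖ ^ r * ‖h.fst‖) ^ 2 + (‖h‖ ^ r * ‖h.snd‖) ^ 2 := by gcongr
    _ = (‖h‖ ^ r) ^ 2 * (‖h.fst‖ ^ 2 + ‖h.snd‖ ^ 2) := by ring
    _ = _ := by
      rw [← pair_norm_sq]
      ring

theorem inner_normPowOp_self {q : ℕ} (hq : 1 ≤ q) (h : Pair n m) :
    inner ℝ (normPowOp q h) h = ‖h.fst‖ ^ (q + 1) + ‖h.snd‖ ^ (q + 1) := by
  obtain ⟨r, rfl⟩ : ∃ r, q = r + 1 := ⟨q - 1, by omega⟩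
  simp only [pair_inner, normPowOp, mkPair_fst, mkPair_snd, Nat.add_sub_cancel,
    real_inner_smul_left, real_inner_self_eq_norm_sq]
  ring

theorem inner_norm_smul_sub_nonneg {E : Type*} [NormedAddCommGroup E] [InnerProductSpace ℝ E]
    (x y : E) : 0 ≤ inner ℝ (‖x‖ • x - ‖y‖ • y) (x - y) := by
  have e : inner ℝ (‖x‖ • x - ‖y‖ • y) (x - y) =
      ‖x‖ ^ 3 + ‖y‖ ^ 3 - (‖x‖ + ‖y‖) * inner ℝ x y := by
    simp only [inner_sub_left, inner_sub_right, real_inner_smul_left, real_inner_self_eq_norm_sq]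
    rw [real_inner_comm x y]
    ring
  rw [e]
  have h1 := real_inner_le_norm x y
  have hx := norm_nonneg x
  have hy := norm_nonneg y
  nlinarith [mul_le_mul_of_nonneg_left h1 (add_nonneg hx hy),
    mul_nonneg (add_nonneg hx hy) (sq_nonneg (‖x‖ - ‖y‖))]

theorem inner_normPowOp_two_sub_nonneg (h k : Pair n m) :
    0 ≤ inner ℝ (normPowOp 2 h - normPowOp 2 k) (h - k) := by
  have h1 := inner_norm_smul_sub_nonneg h.fst k.fst
  have h2 := inner_norm_smul_sub_nonneg h.snd k.snd
  rw [pair_inner]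
  simp only [normPowOp, WithLp.sub_fst, WithLp.sub_snd, mkPair_fst, mkPair_snd, Nat.add_one_sub_one,
    pow_one]
  exact add_nonneg h1 h2

theorem norm_pow_three_le (h : Pair n m) :
    7 / 10 * ‖h‖ ^ 3 ≤ ‖h.fst‖ ^ 3 + ‖h.snd‖ ^ 3 := by
  set a := ‖h.fst‖
  set b := ‖h.snd‖
  have ha : 0 ≤ a := norm_nonneg _
  have hb : 0 ≤ b := norm_nonneg _
  have h0 : ‖h‖ ^ 2 = a ^ 2 + b ^ 2 := pair_norm_sq h
  refine (sq_le_sq₀ (by positivity) (by positivity)).1 ?_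
  have e : (7 / 10 * ‖h‖ ^ 3) ^ 2 = 49 / 100 * (a ^ 2 + b ^ 2) ^ 3 := by
    rw [← h0]
    ring
  have h1 : 0 ≤ (a - b) ^ 2 * (a ^ 4 + 2 * a ^ 3 * b + 2 * a * b ^ 3 + b ^ 4) := by positivity
  rw [e]
  nlinarith [pow_nonneg (add_nonneg (sq_nonneg a) (sq_nonneg b)) 3]

theorem cubicModel_stationary {f : Pair n m → ℝ} (hf : ContDiff ℝ (2 : ℕ) f) {γ : ℝ}
    {z w : Pair n m} (hs : IsSaddle (cubicModel f γ z) w) :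
    saddleOp f z + fderiv ℝ (saddleOp f) z (w - z) + γ • normPowOp 2 (w - z) = 0 := by
  have h := taylorApprox_add_normPowOp_eq_zero (p := 2) (c := γ) (by norm_num) hf (z := z) (w := w)
    (by
      convert hs using 1
      funext w
      simp only [cubicModel]
      norm_num)
  rwa [show 2 - 1 = 1 from rfl, taylorApprox_one] at h

/-- An accepted Newton step contracts the residual as soon as `L ‖F z‖ ≤ μ ^ 2`. The strong
monotonicity and the regularization together give `‖F z‖ ≥ μ ‖d‖ + 0.7 γ ‖d‖ ^ 2`, and the
acceptance test gives `γ ‖d‖ ≤ μ`; this leaves a factor `4 / 5` also for a large `γ`. -/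
theorem norm_newton_le {F : Pair n m → Pair n m} {B : Pair n m →L[ℝ] Pair n m} {μ L γ : ℝ}
    {z d : Pair n m} (hμ : 0 < μ) (hγ : 0 ≤ γ)
    (hB : μ * ‖d‖ ^ 2 ≤ inner ℝ (B d) d)
    (hT : ‖F (z + d) - (F z + B d)‖ ≤ L / 2 * ‖d‖ ^ 2)
    (hd : F z + B d + γ • normPowOp 2 d = 0)
    (hacc : γ * (‖d.fst‖ + ‖d.snd‖) ≤ μ)
    (hz : L * ‖F z‖ ≤ μ ^ 2) : ‖F (z + d)‖ ≤ 4 / 5 * ‖F z‖ := by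
  have hsum : ‖d‖ ≤ ‖d.fst‖ + ‖d.snd‖ := by
    refine (sq_le_sq₀ (norm_nonneg _) (by positivity)).1 ?_
    rw [pair_norm_sq]
    nlinarith [mul_nonneg (norm_nonneg d.fst) (norm_nonneg d.snd)]
  have hγd : γ * ‖d‖ ≤ μ := (mul_le_mul_of_nonneg_left hsum hγ).trans hacc
  have h1 : μ * ‖d‖ ^ 2 + 7 / 10 * γ * ‖d‖ ^ 3 ≤ ‖F z‖ * ‖d‖ := by
    have e : F z = -(B d + γ • normPowOp 2 d) := by
      rw [add_assoc] at hd
      exact eq_neg_of_add_eq_zero_left hd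
    have h2 := abs_real_inner_le_norm (F z) d
    have h3 := (abs_le.1 h2).1
    rw [e, inner_neg_left, inner_add_left, real_inner_smul_left,
      inner_normPowOp_self (by norm_num), ← e] at h3
    have h4 := mul_le_mul_of_nonneg_left (norm_pow_three_le d) hγ
    have h5 : ‖d.fst‖ ^ (2 + 1) + ‖d.snd‖ ^ (2 + 1) = ‖d.fst‖ ^ 3 + ‖d.snd‖ ^ 3 := rfl
    rw [h5] at h3
    linarith
  have h2 : ‖F (z + d)‖ ≤ L / 2 * ‖d‖ ^ 2 + γ * ‖d‖ ^ 2 := by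
    have e : F (z + d) = (F (z + d) - (F z + B d)) + -(γ • normPowOp 2 d) := by
      rw [← eq_neg_of_add_eq_zero_left hd]
      abel
    rw [e]
    refine (norm_add_le _ _).trans (add_le_add hT ?_)
    rw [norm_neg, norm_smul, Real.norm_of_nonneg hγ]
    exact mul_le_mul_of_nonneg_left (norm_normPowOp_le (by norm_num) d) hγ
  rcases (norm_nonneg d).eq_or_lt with h0 | h0
  · rw [← h0] at h2
    norm_num at h2
    simp [h2]
  · set δ := ‖d‖
    set r := ‖F z‖
    have h3 : μ * δ + 7 / 10 * (γ * δ) * δ ≤ r := by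
      refine le_of_mul_le_mul_right ?_ h0
      nlinarith
    set P := μ * δ with hP
    set Q := γ * δ * δ with hQ
    have hPpos : 0 < P := by positivity
    have hQ0 : 0 ≤ Q := by positivity
    have hQP : Q ≤ P := mul_le_mul_of_nonneg_right hγd h0.le
    have h3' : P + 7 / 10 * Q ≤ r := by
      rw [hQ]
      linarith
    have hr : 0 < r := by linarith
    refine le_of_mul_le_mul_left ?_ hr
    have h4 : r * ‖F (z + d)‖ ≤ P ^ 2 / 2 + r * Q := by
      have h5 := mul_le_mul_of_nonneg_left h2 hr.le
      have h6 := mul_le_mul_of_nonneg_right hz (sq_nonneg δ)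
      calc _ ≤ _ := h5
        _ = L * r * δ ^ 2 / 2 + r * Q := by
          rw [hQ]
          ring
        _ ≤ μ ^ 2 * δ ^ 2 / 2 + r * Q := by linarith
        _ = _ := by
          rw [hP]
          ring
    nlinarith [mul_nonneg (sub_nonneg.2 h3') (sub_nonneg.2 hQP), mul_nonneg hQ0 (sub_nonneg.2 hQP),
      mul_nonneg (sub_nonneg.2 h3') hQ0, mul_nonneg hPpos.le (sub_nonneg.2 hQP),
      sq_nonneg (r - (P + 7 / 10 * Q)), mul_nonneg (sub_nonneg.2 h3') hPpos.le]

/-- A Newton step with a small regularization parameter from a point close to the zero `zr` of the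
operator: the residual becomes quadratic in the distance to `zr`. -/
theorem norm_newton_le_of_close {F : Pair n m → Pair n m} {B : Pair n m →L[ℝ] Pair n m}
    {μ L γ : ℝ} {z d zr : Pair n m} (hμ : 0 < μ) (hγ : 0 ≤ γ) (hγL : γ ≤ L / 2)
    (hB : ∀ e, μ * ‖e‖ ^ 2 ≤ inner ℝ (B e) e)
    (hT : ∀ w, ‖F w - (F z + B (w - z))‖ ≤ L / 2 * ‖w - z‖ ^ 2)
    (hd : F z + B d + γ • normPowOp 2 d = 0) (hr : F zr = 0)
    (hclose : 2 * L * ‖z - zr‖ ≤ μ) :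
    ‖F (z + d)‖ ≤ 9 / 4 * (L * ‖z - zr‖ ^ 2) := by
  set e := zr - z with he
  have hen : ‖e‖ = ‖z - zr‖ := norm_sub_rev _ _
  have hL : 0 ≤ L := by linarith
  have h1 := hT zr
  rw [hr, ← he] at h1
  -- the equation for the error `d - e` of the step
  have h2 : B (d - e) + γ • (normPowOp 2 d - normPowOp 2 e) =
      (0 - (F z + B e)) - γ • normPowOp 2 e := by
    have h3 : F z + B d = -(γ • normPowOp 2 d) := eq_neg_of_add_eq_zero_left hd
    rw [map_sub, smul_sub, eq_sub_of_add_eq' h3]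
    abel
  have h3 : μ * ‖d - e‖ ^ 2 ≤ (L * ‖e‖ ^ 2) * ‖d - e‖ := by
    have h4 := hB (d - e)
    have h5 := mul_nonneg hγ (inner_normPowOp_two_sub_nonneg d e)
    have h6 : ‖(0 - (F z + B e)) - γ • normPowOp 2 e‖ ≤ L * ‖e‖ ^ 2 := by
      have h7 := mul_le_mul hγL (norm_normPowOp_le (q := 2) (by norm_num) e) (norm_nonneg _)
        (by linarith)
      refine (norm_sub_le _ _).trans ?_
      rw [norm_smul, Real.norm_of_nonneg hγ]
      linarith
    have h8 := (real_inner_le_norm ((0 - (F z + B e)) - γ • normPowOp 2 e) (d - e)).trans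
      (mul_le_mul_of_nonneg_right h6 (norm_nonneg _))
    rw [← h2, inner_add_left, real_inner_smul_left] at h8
    linarith
  have h4 : ‖d - e‖ ≤ ‖e‖ / 2 := by
    rcases (norm_nonneg (d - e)).eq_or_lt with h0 | h0
    · rw [← h0]
      positivity
    · have h5 : μ * ‖d - e‖ ≤ L * ‖e‖ ^ 2 := by
        refine le_of_mul_le_mul_right ?_ h0
        linarith
      refine le_of_mul_le_mul_left ?_ hμ
      rw [← hen] at hclose
      nlinarith [mul_le_mul_of_nonneg_right hclose (norm_nonneg e)]
  have h5 : ‖d‖ ≤ 3 / 2 * ‖z - zr‖ := by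
    have h6 := norm_add_le (d - e) e
    rw [sub_add_cancel] at h6
    linarith
  have h6 : ‖F (z + d)‖ ≤ L * ‖d‖ ^ 2 := by
    have e1 : F (z + d) = (F (z + d) - (F z + B d)) + -(γ • normPowOp 2 d) := by
      rw [← eq_neg_of_add_eq_zero_left hd]
      abel
    have h7 := hT (z + d)
    rw [add_sub_cancel_left] at h7
    have h8 : ‖γ • normPowOp 2 d‖ ≤ L / 2 * ‖d‖ ^ 2 := by
      rw [norm_smul, Real.norm_of_nonneg hγ]
      exact mul_le_mul hγL (norm_normPowOp_le (by norm_num) d) (norm_nonneg _) (by linarith)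
    rw [e1]
    refine (norm_add_le _ _).trans ?_
    rw [norm_neg]
    linarith
  calc _ ≤ _ := h6
    _ ≤ L * (3 / 2 * ‖z - zr‖) ^ 2 := by gcongr
    _ = _ := by ring

end CubicNewton

/-! ### The tensor step -/

section TensorStep

variable {n m : ℕ}

/-- The power mean inequality between `‖(x, y)‖` and the norms of its components. -/
theorem norm_pow_succ_le {p : ℕ} (hp : 1 ≤ p) (h : Pair n m) :
    ‖h‖ ^ (p + 1) ≤ Real.sqrt 2 ^ (p - 1) * (‖h.fst‖ ^ (p + 1) + ‖h.snd‖ ^ (p + 1)) := by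
  obtain ⟨q, rfl⟩ : ∃ q, p = q + 1 := ⟨p - 1, by omega⟩
  have e : ∀ x : ℝ, 0 ≤ x → (x ^ 2) ^ (((q + 2 : ℕ) : ℝ) / 2) = x ^ (q + 2) := by
    intro x hx
    rw [← Real.rpow_natCast x 2, ← Real.rpow_mul hx, ← Real.rpow_natCast]
    congr 1
    push_cast
    ring
  have h1 := NNReal.coe_le_coe.2 (NNReal.rpow_add_le_mul_rpow_add_rpow (‖h.fst‖₊ ^ 2)
    (‖h.snd‖₊ ^ 2) (p := ((q + 2 : ℕ) : ℝ) / 2)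
    (by push_cast; linarith [Nat.cast_nonneg (α := ℝ) q]))
  simp only [NNReal.coe_rpow, NNReal.coe_add, NNReal.coe_mul, NNReal.coe_pow, coe_nnnorm,
    NNReal.coe_ofNat] at h1
  rw [← pair_norm_sq, e _ (norm_nonneg _), e _ (norm_nonneg _), e _ (norm_nonneg _)] at h1
  have e2 : (2 : ℝ) ^ (((q + 2 : ℕ) : ℝ) / 2 - 1) = Real.sqrt 2 ^ q := by
    rw [Real.sqrt_eq_rpow, ← Real.rpow_natCast, ← Real.rpow_mul (by norm_num)]
    congr 1
    push_cast
    ring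
  rw [e2] at h1
  exact h1

theorem tensorModel_stationary {p : ℕ} (hp : 1 ≤ p) {f : Pair n m → ℝ} (hf : ContDiff ℝ (p : ℕ) f)
    {M : ℝ} {z w : Pair n m} (hs : IsTensorStep f p M z w) :
    taylorApprox (saddleOp f) (p - 1) z w +
      (M * Real.sqrt 2 ^ (p - 1) / (p ! : ℝ)) • normPowOp p (w - z) = 0 := by
  refine taylorApprox_add_normPowOp_eq_zero hp hf ?_
  have e : M * Real.sqrt 2 ^ (p - 1) / (p ! : ℝ) / (p + 1) =
      M * Real.sqrt 2 ^ (p - 1) / ((p + 1)! : ℝ) := by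
    rw [div_div, Nat.factorial_succ]
    push_cast
    ring
  rw [e]
  exact hs

/-- The length of the tensor step is bounded by the residual at its starting point, and the
residual at its end by the length. The first bound needs only the monotonicity of the operator,
not that of its Taylor model: the regularization dominates the Taylor remainder. -/
theorem tensorStep_bounds {F : Pair n m → Pair n m} {p : ℕ} {L μ : ℝ} {z w : Pair n m}
    (hp : 2 ≤ p) (hL : 0 ≤ L) (hμ : 0 < μ)
    (hm : μ * ‖w - z‖ ^ 2 ≤ inner ℝ (F w - F z) (w - z))
    (hT : ‖F w - taylorApprox F (p - 1) z w‖ ≤ L / (p ! : ℝ) * ‖w - z‖ ^ p)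
    (hw : taylorApprox F (p - 1) z w +
      (Real.sqrt 2 * p * L * Real.sqrt 2 ^ (p - 1) / (p ! : ℝ)) • normPowOp p (w - z) = 0) :
    L / (p ! : ℝ) * ‖w - z‖ ^ (p + 1) ≤ ‖F z‖ ^ 2 / (4 * μ) ∧
      ‖F w‖ ≤ (1 + p * Real.sqrt 2 ^ p) * (L / (p ! : ℝ)) * ‖w - z‖ ^ p := by
  set h := w - z with hh
  set K := L / (p ! : ℝ) with hK
  have hK0 : 0 ≤ K := by positivity
  have hs1 : 1 ≤ Real.sqrt 2 := by
    rw [Real.one_le_sqrt]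
    norm_num
  have hp2 : (2 : ℝ) ≤ p := by exact_mod_cast hp
  set c := Real.sqrt 2 * p * L * Real.sqrt 2 ^ (p - 1) / (p ! : ℝ) with hc
  have hc1 : c = Real.sqrt 2 * p * K * Real.sqrt 2 ^ (p - 1) := by
    rw [hc, hK]
    ring
  have hc2 : c = p * Real.sqrt 2 ^ p * K := by
    obtain ⟨q, rfl⟩ : ∃ q, p = q + 1 := ⟨p - 1, by omega⟩
    rw [hc1, pow_succ, Nat.add_sub_cancel]
    ring
  have hc0 : 0 ≤ c := by
    rw [hc2]
    positivity
  have eF : F w = (F w - taylorApprox F (p - 1) z w) + -(c • normPowOp p h) := by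
    rw [← eq_neg_of_add_eq_zero_left hw]
    abel
  constructor
  · have h1 : inner ℝ (F w) h ≤ K * ‖h‖ ^ (p + 1) - 2 * K * ‖h‖ ^ (p + 1) := by
      rw [eF, inner_add_left, inner_neg_left, real_inner_smul_left,
        inner_normPowOp_self (by omega)]
      have h2 := (real_inner_le_norm (F w - taylorApprox F (p - 1) z w) h).trans
        (mul_le_mul_of_nonneg_right hT (norm_nonneg h))
      have h3 : 2 * K * ‖h‖ ^ (p + 1) ≤ c * (‖h.fst‖ ^ (p + 1) + ‖h.snd‖ ^ (p + 1)) := by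
        have h4 := mul_le_mul_of_nonneg_left (norm_pow_succ_le (p := p) (by omega) h)
          (show 0 ≤ Real.sqrt 2 * p * K by positivity)
        have h5 : 2 * K * ‖h‖ ^ (p + 1) ≤ Real.sqrt 2 * p * K * ‖h‖ ^ (p + 1) := by
          gcongr
          nlinarith
        rw [hc1]
        linarith
      have h6 : K * ‖h‖ ^ p * ‖h‖ = K * ‖h‖ ^ (p + 1) := by ring
      linarith
    rw [inner_sub_left] at hm
    have h2 := (abs_le.1 (abs_real_inner_le_norm (F z) h)).1
    rw [le_div_iff₀ (by positivity)]
    nlinarith [sq_nonneg (‖F z‖ - 2 * μ * ‖h‖)]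
  · rw [eF]
    refine (norm_add_le _ _).trans ?_
    rw [norm_neg, norm_smul, Real.norm_of_nonneg hc0]
    have h1 := mul_le_mul_of_nonneg_left (norm_normPowOp_le (q := p) (by omega) h) hc0
    rw [hc2] at h1 ⊢
    linarith

/-- The tensor step of order one is a gradient step. -/
theorem norm_tensorStep_one_le {F : Pair n m → Pair n m} {L M μ : ℝ} {z w : Pair n m}
    (hM : 0 < M) (hμ : 0 ≤ μ) (hμM : μ ≤ M)
    (hT : ‖F w - F z - μ • (w - z)‖ ≤ L * ‖w - z‖)
    (hw : F z + M • (w - z) = 0) : M * ‖F w‖ ≤ (L + M) * ‖F z‖ := by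
  have h1 : M * ‖w - z‖ = ‖F z‖ := by
    rw [eq_neg_of_add_eq_zero_left hw, norm_neg, norm_smul, Real.norm_of_nonneg hM.le]
  have h2 : F w = (F w - F z - μ • (w - z)) - (M - μ) • (w - z) := by
    rw [sub_smul, ← sub_eq_zero]
    calc _ = F z + M • (w - z) := by abel
      _ = 0 := hw
  have h3 : ‖F w‖ ≤ (L + M) * ‖w - z‖ := by
    rw [h2]
    refine (norm_sub_le _ _).trans ?_
    rw [norm_smul, Real.norm_of_nonneg (by linarith)]
    nlinarith [mul_nonneg hμ (norm_nonneg (w - z))]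
  calc M * ‖F w‖ ≤ M * ((L + M) * ‖w - z‖) := by gcongr
    _ = (L + M) * (M * ‖w - z‖) := by ring
    _ = _ := by rw [h1]

namespace Params

variable {P : Params}

theorem μ_pos (hR : 0 < P.R) (hε : 0 < P.ε) : 0 < P.μ := by
  unfold μ
  positivity

theorem M_pos (hp : 1 ≤ P.p) (hLp : 0 < P.Lp) : 0 < P.M := by
  have : (0 : ℝ) < P.p := by exact_mod_cast hp
  unfold M
  positivity

theorem gapAccuracy_pos (hp : 1 ≤ P.p) (hLp : 0 < P.Lp) (hε : 0 < P.ε) : 0 < P.gapAccuracy := by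
  have h1 : (0 : ℝ) < P.p := by exact_mod_cast hp
  have h2 := M_pos hp hLp
  unfold gapAccuracy
  positivity

/-- The definition of `ε'` without real exponents. -/
theorem gapAccuracy_pow (hp : 1 ≤ P.p) (hLp : 0 < P.Lp) (hε : 0 < P.ε) :
    P.gapAccuracy ^ P.p * (Real.sqrt 2 ^ (2 * P.p ^ 2 + 3 * P.p + 3) *
      ((P.p : ℝ) * ((P.p + 1)! : ℝ)) ^ P.p * P.M) = P.ε ^ (P.p + 1) := by
  have h1 : (0 : ℝ) < P.p := by exact_mod_cast hp
  have h2 := M_pos hp hLp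
  have e1 : (P.ε ^ (((P.p : ℝ) + 1) / P.p)) ^ P.p = P.ε ^ (P.p + 1) := by
    rw [← Real.rpow_natCast, ← Real.rpow_mul hε.le, div_mul_cancel₀ _ h1.ne',
      ← Real.rpow_natCast]
    push_cast
    rfl
  have e2 : (P.M ^ (1 / (P.p : ℝ))) ^ P.p = P.M := by
    rw [← Real.rpow_natCast, ← Real.rpow_mul h2.le, div_mul_cancel₀ _ h1.ne', Real.rpow_one]
  have e3 : ((2 : ℝ) ^ ((2 * (P.p : ℝ) ^ 2 + 3 * P.p + 3) / (2 * P.p))) ^ P.p =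
      Real.sqrt 2 ^ (2 * P.p ^ 2 + 3 * P.p + 3) := by
    rw [Real.sqrt_eq_rpow, ← Real.rpow_natCast _ P.p, ← Real.rpow_natCast _ (_ + 3),
      ← Real.rpow_mul (by norm_num), ← Real.rpow_mul (by norm_num)]
    congr 1
    push_cast
    field_simp
  rw [gapAccuracy, div_pow, mul_pow, mul_assoc (2 ^ _ : ℝ), mul_pow, e1, e2, e3]
  have : (0 : ℝ) < ((P.p + 1)! : ℝ) := by positivity
  field_simp

theorem meritAccuracy_le (hL1 : 0 < P.L1) (hμ : 0 < P.μ) (hg : 0 < P.gapAccuracy) :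
    P.meritAccuracy ≤ P.μ * P.gapAccuracy := by
  unfold meritAccuracy
  rw [div_le_iff₀ (by positivity)]
  nlinarith [mul_pos (mul_pos hμ hg) hL1]

end Params

theorem one_add_mul_sqrt_two_pow_le {p : ℕ} (hp : 2 ≤ p) :
    (1 + p * Real.sqrt 2 ^ p) ^ (p + 1) * (8 / 3) ^ (p + 1) ≤
      (p ! : ℝ) * (Real.sqrt 2 * p) *
        (Real.sqrt 2 ^ (2 * p ^ 2 + 3 * p + 3) * ((p : ℝ) * ((p + 1)! : ℝ)) ^ p) := by
  set s := Real.sqrt 2 with hs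
  have hs1 : 1 ≤ s := by
    rw [hs, Real.one_le_sqrt]
    norm_num
  have hs2 : s ^ 2 = 2 := Real.sq_sqrt (by norm_num)
  have hs3 : 8 / 3 ≤ s ^ 3 := by
    have : 4 / 3 ≤ s := by
      rw [hs]
      exact Real.le_sqrt_of_sq_le (by norm_num)
    nlinarith
  have hp2 : (2 : ℝ) ≤ p := by exact_mod_cast hp
  have hfac : (1 : ℝ) ≤ p ! := by exact_mod_cast Nat.factorial_pos p
  have h1 : 1 + p * s ^ p ≤ (p + 1) * s ^ p := by
    have := one_le_pow₀ hs1 (n := p)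
    linarith
  have h2 : (8 / 3 : ℝ) ^ (p + 1) ≤ (s ^ (p + 1)) ^ (p + 1) := by
    refine pow_le_pow_left₀ (by norm_num) (hs3.trans ?_) _
    exact pow_le_pow_right₀ hs1 (by omega)
  have h3 : ((p : ℝ) + 1) ≤ p * p := by nlinarith
  have h4 : (p : ℝ) * p ≤ p * p ^ p := by
    gcongr
    exact le_self_pow₀ (by linarith) (by omega)
  calc (1 + p * s ^ p) ^ (p + 1) * (8 / 3) ^ (p + 1)
      ≤ ((p + 1) * s ^ p) ^ (p + 1) * (s ^ (p + 1)) ^ (p + 1) := by gcongr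
    _ = (p + 1) * (p + 1) ^ p * s ^ (2 * p ^ 2 + 3 * p + 1) := by
        rw [mul_pow]
        ring
    _ ≤ (p * p ^ p) * (p + 1) ^ p * s ^ (2 * p ^ 2 + 3 * p + 4) := by
        gcongr
        · linarith
        · norm_num
    _ = 1 * (1 * s * p * (s ^ (2 * p ^ 2 + 3 * p + 3) * (p * ((p + 1) * 1)) ^ p)) := by
        rw [mul_one ((p : ℝ) + 1), mul_pow]
        ring
    _ ≤ 1 * (p ! * s * p * (s ^ (2 * p ^ 2 + 3 * p + 3) * (p * ((p + 1) * p !)) ^ p)) := by gcongr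
    _ = _ := by
        rw [Nat.factorial_succ]
        push_cast
        ring

/-- The tensor step turns the accuracy `ε'` into a residual of at most `3 ε / 8`. -/
theorem norm_saddleOp_tensorStep_le {P : Params} {g : Pair n m → ℝ} {z₁ z w : Pair n m}
    (hp : 1 ≤ P.p) (hL1 : 0 < P.L1) (hLp : 0 < P.Lp) (hR : 0 < P.R) (hε : 0 < P.ε)
    (hεp : P.p = 1 → P.ε ≤ 4 * P.R * P.Lp) (hg : ConvexConcave g) (hd : Differentiable ℝ g)
    (hC : ContDiff ℝ (P.p : ℕ) g) (hLip : LipschitzDeriv P.p P.Lp g)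
    (hout : IsOutput P g z₁ (fun _ => z) 0 w) :
    ‖saddleOp (regularized g P.μ z₁) w‖ ≤ 3 / 8 * P.ε := by
  have hμ : 0 < P.μ := P.μ_pos hR hε
  have hM : 0 < P.M := P.M_pos hp hLp
  have hgap : 0 < P.gapAccuracy := P.gapAccuracy_pos hp hLp hε
  obtain ⟨hmer, hstep⟩ := hout
  have h1 := tensorModel_stationary hp (contDiff_regularized hC P.μ z₁) hstep
  set F := saddleOp (regularized g P.μ z₁) with hF
  have h2 : ‖F z‖ ^ 2 ≤ 2 * P.μ * P.gapAccuracy := by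
    have h3 := hmer.trans (P.meritAccuracy_le hL1 hμ hgap)
    unfold merit at h3
    rw [← hF] at h3
    linarith
  have hgp := P.gapAccuracy_pow hp hLp hε
  rcases hp.eq_or_lt with hp1 | hp2
  · rw [← hp1] at h1 hgp hLip hC
    have hMeq : P.M = Real.sqrt 2 * P.Lp := by
      rw [Params.M, ← hp1]
      simp
    have hμL : P.μ ≤ P.Lp := by
      rw [Params.μ, div_le_iff₀ (by positivity)]
      linarith [hεp hp1.symm]
    set s := Real.sqrt 2 with hs
    have hs1 : 1 ≤ s := by
      rw [hs, Real.one_le_sqrt]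
      norm_num
    have hs2 : s ^ 2 = 2 := Real.sq_sqrt (by norm_num)
    have h3 : F z + P.M • (w - z) = 0 := by
      rw [normPowOp_one] at h1
      simpa [taylorApprox] using h1
    have hT : ‖F w - F z - P.μ • (w - z)‖ ≤ P.Lp * ‖w - z‖ := by
      have h4 := norm_saddleOp_regularized_sub_le le_rfl hC hLip z₁ w z
      simp only [saddleOp_regularized hd, zero_smul, add_zero] at h4
      have e : F w - F z - P.μ • (w - z) = saddleOp g w - saddleOp g z := by
        rw [hF, saddleOp_regularized hd, saddleOp_regularized hd, smul_sub, smul_sub, smul_sub]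
        abel
      rwa [e]
    have hμM : P.μ ≤ P.M := by
      rw [hMeq]
      nlinarith
    have h5 := norm_tensorStep_one_le hM hμ.le hμM hT h3
    rw [hMeq] at h5 hgp
    have h6 : s * ‖F w‖ ≤ (1 + s) * ‖F z‖ := by
      refine le_of_mul_le_mul_left ?_ hLp
      linarith
    have h7 : 32 * s * P.Lp * P.gapAccuracy = P.ε ^ 2 := by
      have e8 : s ^ 8 = 16 := by
        calc s ^ 8 = (s ^ 2) ^ 4 := by ring
          _ = 16 := by rw [hs2]; norm_num
      norm_num [e8] at hgp
      linarith
    have h8 : 16 * s * ‖F z‖ ^ 2 ≤ P.ε ^ 2 := by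
      rw [← h7]
      have : P.μ * P.gapAccuracy ≤ P.Lp * P.gapAccuracy := by gcongr
      nlinarith
    have h9 : (s * ‖F w‖) ^ 2 ≤ ((1 + s) * ‖F z‖) ^ 2 := by gcongr
    rw [mul_pow, mul_pow, hs2] at h9
    have hs3 : 7 / 5 ≤ s := by
      rw [hs]
      exact Real.le_sqrt_of_sq_le (by norm_num)
    have h10 : ‖F w‖ ^ 2 ≤ (3 / 8 * P.ε) ^ 2 := by
      have h11 : (1 + s) ^ 2 = 3 + 2 * s := by
        linear_combination hs2
      rw [h11] at h9
      have h12 : 32 * s * ‖F w‖ ^ 2 ≤ (3 + 2 * s) * P.ε ^ 2 := by nlinarith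
      have h13 : (3 + 2 * s) * P.ε ^ 2 ≤ (32 * s) * (9 / 64 * P.ε ^ 2) := by
        nlinarith [sq_nonneg P.ε]
      have h14 := le_of_mul_le_mul_left (h12.trans h13) (by positivity)
      linarith
    exact (sq_le_sq₀ (norm_nonneg _) (by positivity)).1 h10
  · have hT := norm_saddleOp_regularized_sub_taylorApprox_le_of_two_le hp2 P.μ hC hLip z₁ z w
    obtain ⟨h3, h4⟩ := tensorStep_bounds hp2 hLp.le hμ
      (stronglyMonotone_regularized hg hd P.μ z₁ w z) hT h1
    rw [← hF] at h3 h4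
    set K := P.Lp / (P.p ! : ℝ) with hK
    have hKpos : 0 < K := by positivity
    have h5 : K * ‖w - z‖ ^ (P.p + 1) ≤ P.gapAccuracy := by
      refine h3.trans ?_
      rw [div_le_iff₀ (by positivity)]
      nlinarith [mul_pos hμ hgap]
    set A := 1 + (P.p : ℝ) * Real.sqrt 2 ^ P.p with hA
    have hApos : 0 < A := by positivity
    have hcomb := one_add_mul_sqrt_two_pow_le hp2
    rw [← hA] at hcomb
    have h6 : (A * K * ‖w - z‖ ^ P.p) ^ (P.p + 1) ≤ (3 / 8 * P.ε) ^ (P.p + 1) := by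
      have e1 : (A * K * ‖w - z‖ ^ P.p) ^ (P.p + 1) =
          A ^ (P.p + 1) * K * (K * ‖w - z‖ ^ (P.p + 1)) ^ P.p := by
        simp only [mul_pow]
        ring
      rw [e1, mul_pow (3 / 8 : ℝ), ← hgp]
      have h7 : A ^ (P.p + 1) * K ≤ (3 / 8) ^ (P.p + 1) *
          (Real.sqrt 2 ^ (2 * P.p ^ 2 + 3 * P.p + 3) *
            ((P.p : ℝ) * ((P.p + 1)! : ℝ)) ^ P.p * P.M) := by
        have e2 : (8 / 3 : ℝ) ^ (P.p + 1) * (3 / 8) ^ (P.p + 1) = 1 := by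
          rw [← mul_pow]
          norm_num
        have hfac : (0 : ℝ) < (P.p ! : ℝ) := by positivity
        have h8 := mul_le_mul_of_nonneg_right hcomb
          (show 0 ≤ (3 / 8) ^ (P.p + 1) * K by positivity)
        have e3 : K * (P.p ! : ℝ) = P.Lp := by
          rw [hK]
          field_simp
        calc A ^ (P.p + 1) * K
            = A ^ (P.p + 1) * (8 / 3) ^ (P.p + 1) * ((3 / 8) ^ (P.p + 1) * K) := by
              linear_combination (-(A ^ (P.p + 1) * K)) * e2
          _ ≤ _ := h8
          _ = _ := by
              rw [Params.M, ← e3]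
              ring
      calc A ^ (P.p + 1) * K * (K * ‖w - z‖ ^ (P.p + 1)) ^ P.p
          ≤ ((3 / 8) ^ (P.p + 1) * (Real.sqrt 2 ^ (2 * P.p ^ 2 + 3 * P.p + 3) *
            ((P.p : ℝ) * ((P.p + 1)! : ℝ)) ^ P.p * P.M)) * P.gapAccuracy ^ P.p := by
            gcongr
        _ = _ := by ring
    exact h4.trans (le_of_pow_le_pow_left₀ (by omega) (by positivity) h6)

end TensorStep

/-! ### Complexity -/

section Complexity

variable {n m : ℕ}

/-- What an accepted cubic-regularized Newton step `d` provides. The choice between `d` and `α d`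
never makes the residual larger than that of the full step. -/
theorem CubicNewtonStep.exists_direction {f : Pair n m → ℝ} {μ γbar ρ α : ℝ} {z z' : Pair n m}
    (hf : ContDiff ℝ (2 : ℕ) f) (hγ : 0 ≤ γbar) (hρ : 0 ≤ ρ) (hρ1 : ρ ≤ 1)
    (h : CubicNewtonStep f μ γbar ρ α z z') :
    ∃ (γ : ℝ) (d : Pair n m), 0 ≤ γ ∧ γ ≤ γbar ∧ γ * (‖d.fst‖ + ‖d.snd‖) ≤ μ ∧
      saddleOp f z + fderiv ℝ (saddleOp f) z d + γ • normPowOp 2 d = 0 ∧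
      ‖saddleOp f z'‖ ≤ ‖saddleOp f (z + d)‖ := by
  obtain ⟨j, trial, hs, -, hacc, hz'⟩ := h
  refine ⟨γbar * ρ ^ j, trial j - z, by positivity,
    mul_le_of_le_one_right hγ (pow_le_one₀ hρ hρ1), hacc, cubicModel_stationary hf (hs j le_rfl), ?_⟩
  have h1 : merit f z' ≤ merit f (z + (trial j - z)) := by
    rcases hz' with ⟨h1, rfl⟩ | ⟨-, rfl⟩
    · exact h1.le
    · exact le_rfl
  unfold merit at h1
  exact (sq_le_sq₀ (norm_nonneg _) (norm_nonneg _)).1 (by linarith)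

theorem le_sqrt_pow_of_rpow_le {p : ℕ} {Z T : ℝ} (hZ : 0 ≤ Z)
    (h : Z ^ ((2 : ℝ) / ((p : ℝ) + 1)) ≤ T) : Z ≤ Real.sqrt T ^ (p + 1) := by
  have hp : (0 : ℝ) < (p : ℝ) + 1 := by positivity
  have h0 : 0 ≤ Z ^ ((2 : ℝ) / ((p : ℝ) + 1)) := by positivity
  have e1 : (Z ^ ((2 : ℝ) / ((p : ℝ) + 1))) ^ (((p : ℝ) + 1) / 2) = Z := by
    rw [← Real.rpow_mul hZ, div_mul_div_cancel₀ hp.ne', div_self two_ne_zero, Real.rpow_one]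
  have e2 : Real.sqrt T ^ (p + 1) = T ^ (((p : ℝ) + 1) / 2) := by
    rw [Real.sqrt_eq_rpow, ← Real.rpow_natCast, ← Real.rpow_mul (h0.trans h)]
    congr 1
    push_cast
    ring
  rw [e2]
  nth_rewrite 1 [← e1]
  exact Real.rpow_le_rpow h0 h (by positivity)

namespace Params

variable {P : Params}

theorem one_le_ξ : 1 ≤ P.ξ := le_max_left _ _

theorem L1_le_μ_mul_ξ (hR : 0 < P.R) (hε : 0 < P.ε) : P.L1 ≤ P.μ * P.ξ := by
  have h1 : 4 * P.R * P.L1 / P.ε ≤ P.ξ := le_max_right _ _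
  have h2 : P.μ * (4 * P.R * P.L1 / P.ε) = P.L1 := by
    unfold μ
    field_simp
  calc P.L1 = P.μ * (4 * P.R * P.L1 / P.ε) := h2.symm
    _ ≤ _ := mul_le_mul_of_nonneg_left h1 (μ_pos hR hε).le

theorem ε_eq (hR : 0 < P.R) : P.ε = 4 * P.R * P.μ := by
  unfold μ
  field_simp

/-- The number of restarts is chosen such that the final distance is at most `μ / (2 L₂ ξ)`. -/
theorem restarts_spec (hL2 : 0 < P.L2) (hR : 0 < P.R) (hε : 0 < P.ε) :
    2 * P.L2 * P.ξ * (P.R / 2 ^ P.restarts) ≤ P.μ := by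
  have hμ := P.μ_pos hR hε
  have hξ : 0 < P.ξ := zero_lt_one.trans_le P.one_le_ξ
  have h1 : Real.logb 2 (P.L2 * P.R * P.ξ / P.μ) + 1 ≤ P.restarts := Nat.le_ceil _
  have h2 := Real.rpow_le_rpow_of_exponent_le (x := 2) (by norm_num) h1
  rw [Real.rpow_add (by norm_num), Real.rpow_logb (by norm_num) (by norm_num) (by positivity),
    Real.rpow_one, Real.rpow_natCast, div_mul_eq_mul_div, div_le_iff₀ hμ] at h2
  rw [mul_div_assoc', div_le_iff₀ (by positivity)]
  linarith

theorem innerIters_spec (hLp : 0 < P.Lp) (hR : 0 < P.R) (hε : 0 < P.ε) (i : ℕ) :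
    0 < P.innerIters i ∧ 64 * P.Lp * (P.R / 2 ^ i) ^ (P.p - 1) / P.μ ≤
      Real.sqrt (P.innerIters i) ^ (P.p + 1) := by
  have hμ := P.μ_pos hR hε
  constructor
  · unfold innerIters
    rw [Nat.ceil_pos]
    positivity
  · exact le_sqrt_pow_of_rpow_le (by positivity) (Nat.le_ceil _)

theorem restarts_le (hL2 : 0 < P.L2) (hR : 0 < P.R) (hε : 0 < P.ε) :
    (P.restarts : ℝ) ≤ 6 * max 1 (Real.log (P.L2 * P.R ^ 2 * P.ξ / P.ε)) := by
  have hξ : 0 < P.ξ := zero_lt_one.trans_le P.one_le_ξ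
  set Y := P.L2 * P.R ^ 2 * P.ξ / P.ε with hY
  have hYpos : 0 < Y := by positivity
  set Λ := max 1 (Real.log Y)
  have hΛ1 : 1 ≤ Λ := le_max_left _ _
  have hΛ2 : Real.log Y ≤ Λ := le_max_right _ _
  have e1 : P.L2 * P.R * P.ξ / P.μ = 2 ^ 2 * Y := by
    rw [hY, μ]
    field_simp
    norm_num
  have h1 : Real.logb 2 (P.L2 * P.R * P.ξ / P.μ) + 1 ≤ 2 * Λ + 3 := by
    rw [e1, Real.logb_mul (by norm_num) hYpos.ne']
    have h2 : Real.logb 2 ((2 : ℝ) ^ 2) = 2 := by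
      rw [Real.logb_pow, Real.logb_self_eq_one (by norm_num)]
      norm_num
    have h3 : Real.logb 2 Y ≤ 2 * Λ := by
      have hlog2 := Real.log_two_gt_d9
      rw [Real.logb, div_le_iff₀ (by linarith)]
      nlinarith
    linarith
  have h2 : P.restarts ≤ ⌈2 * Λ + 3⌉₊ := Nat.ceil_mono h1
  have h3 := Nat.ceil_lt_add_one (a := 2 * Λ + 3) (by linarith)
  have h4 : (P.restarts : ℝ) ≤ (⌈2 * Λ + 3⌉₊ : ℝ) := by exact_mod_cast h2
  linarith

theorem innerIters_le (hp : 1 ≤ P.p) (hLp : 0 < P.Lp) (hR : 0 < P.R) (hε : 0 < P.ε) (i : ℕ) :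
    (P.innerIters i : ℝ) ≤
      257 * max 1 (P.Lp * P.R ^ P.p / P.ε) ^ ((2 : ℝ) / ((P.p : ℝ) + 1)) := by
  have hμ := P.μ_pos hR hε
  have hp1 : (1 : ℝ) ≤ P.p := by exact_mod_cast hp
  set X := P.Lp * P.R ^ P.p / P.ε with hX
  set e := (2 : ℝ) / ((P.p : ℝ) + 1) with he
  have he0 : 0 ≤ e := by positivity
  have he1 : e ≤ 1 := by
    rw [he, div_le_one (by positivity)]
    linarith
  have hQ : 1 ≤ max 1 X ^ e := Real.one_le_rpow (le_max_left _ _) he0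
  have h1 : 64 * P.Lp * (P.R / 2 ^ i) ^ (P.p - 1) / P.μ ≤ 256 * max 1 X := by
    have h2 : P.R / 2 ^ i ≤ P.R := div_le_self hR.le (one_le_pow₀ (by norm_num))
    have h3 : 64 * P.Lp * P.R ^ (P.p - 1) / P.μ = 256 * X := by
      obtain ⟨q, hq⟩ : ∃ q, P.p = q + 1 := ⟨P.p - 1, by omega⟩
      rw [hX, μ, hq, Nat.add_sub_cancel]
      field_simp
      ring
    calc _ ≤ 64 * P.Lp * P.R ^ (P.p - 1) / P.μ := by gcongr
      _ = 256 * X := h3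
      _ ≤ _ := by
        gcongr
        exact le_max_right _ _
  have h4 : (64 * P.Lp * (P.R / 2 ^ i) ^ (P.p - 1) / P.μ) ^ e ≤ 256 * max 1 X ^ e := by
    calc _ ≤ (256 * max 1 X) ^ e := Real.rpow_le_rpow (by positivity) h1 he0
      _ = 256 ^ e * max 1 X ^ e := Real.mul_rpow (by norm_num) (by positivity)
      _ ≤ 256 ^ (1 : ℝ) * max 1 X ^ e := by
        gcongr
        norm_num
      _ = _ := by rw [Real.rpow_one]
  have h5 := Nat.ceil_lt_add_one
    (a := (64 * P.Lp * (P.R / 2 ^ i) ^ (P.p - 1) / P.μ) ^ e) (by positivity)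
  unfold innerIters
  linarith

/-- The accuracy `ε'` is not much smaller than `ε R`. This bounds the number of contractions by the
factor `4 / 5` that are needed after the residual has become comparable to `ε`. -/
theorem ε_mul_R_le (hp : 1 ≤ P.p) (hLp : 0 < P.Lp) (hR : 0 < P.R) (hε : 0 < P.ε) :
    P.ε * P.R ≤ (Real.sqrt 2 ^ (2 * P.p ^ 2 + 3 * P.p + 3) *
      ((P.p : ℝ) * ((P.p + 1)! : ℝ)) ^ P.p * (Real.sqrt 2 * P.p)) *
        (P.gapAccuracy * max 1 (P.Lp * P.R ^ P.p / P.ε) ^ ((2 : ℝ) / ((P.p : ℝ) + 1))) := by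
  have hp1 : (1 : ℝ) ≤ P.p := by exact_mod_cast hp
  have hs1 : 1 ≤ Real.sqrt 2 := by
    rw [Real.one_le_sqrt]
    norm_num
  have hgap := P.gapAccuracy_pos hp hLp hε
  set X := P.Lp * P.R ^ P.p / P.ε with hX
  have hXpos : 0 < X := by positivity
  set Q := max 1 X ^ ((2 : ℝ) / ((P.p : ℝ) + 1)) with hQ
  set B := Real.sqrt 2 ^ (2 * P.p ^ 2 + 3 * P.p + 3) * ((P.p : ℝ) * ((P.p + 1)! : ℝ)) ^ P.p with hB
  have hfac : (1 : ℝ) ≤ ((P.p + 1)! : ℝ) := by exact_mod_cast Nat.factorial_pos _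
  have hB1 : 1 ≤ B * (Real.sqrt 2 * P.p) := by
    have h1 : 1 ≤ (P.p : ℝ) * ((P.p + 1)! : ℝ) := one_le_mul_of_one_le_of_one_le hp1 hfac
    exact one_le_mul_of_one_le_of_one_le
      (one_le_mul_of_one_le_of_one_le (one_le_pow₀ hs1) (one_le_pow₀ h1))
      (one_le_mul_of_one_le_of_one_le hs1 hp1)
  have hQX : X ≤ Q ^ P.p := by
    rw [hQ, ← Real.rpow_natCast, ← Real.rpow_mul (by positivity)]
    calc X ≤ max 1 X := le_max_right _ _
      _ = max 1 X ^ (1 : ℝ) := (Real.rpow_one _).symm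
      _ ≤ _ := by
        refine Real.rpow_le_rpow_of_exponent_le (le_max_left _ _) ?_
        rw [div_mul_eq_mul_div, le_div_iff₀ (by positivity)]
        linarith
  have hQ0 : 0 ≤ Q := by positivity
  have hgp := P.gapAccuracy_pow hp hLp hε
  rw [← hB, M] at hgp
  refine le_of_pow_le_pow_left₀ (n := P.p) (by omega) (by positivity) ?_
  have e1 : (P.ε * P.R) ^ P.p = B * (Real.sqrt 2 * P.p) * (P.gapAccuracy ^ P.p * X) := by
    have h1 : X * P.ε = P.Lp * P.R ^ P.p := by
      rw [hX]
      field_simp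
    refine mul_right_cancel₀ hε.ne' ?_
    calc (P.ε * P.R) ^ P.p * P.ε = P.ε ^ (P.p + 1) * P.R ^ P.p := by
          rw [mul_pow]
          ring
      _ = P.gapAccuracy ^ P.p * (B * (Real.sqrt 2 * P.p)) * (P.Lp * P.R ^ P.p) := by
          rw [← hgp]
          ring
      _ = _ := by
          rw [← h1]
          ring
  rw [e1]
  calc B * (Real.sqrt 2 * P.p) * (P.gapAccuracy ^ P.p * X)
      ≤ (B * (Real.sqrt 2 * P.p)) ^ P.p * (P.gapAccuracy ^ P.p * Q ^ P.p) := by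
        gcongr
        exact le_self_pow₀ hB1 (by omega)
    _ = _ := by rw [mul_pow _ (P.gapAccuracy * Q), mul_pow P.gapAccuracy]

theorem le_meritAccuracy (hL1 : 0 < P.L1) (hμ : 0 < P.μ) (hg : 0 < P.gapAccuracy) {c : ℝ}
    (hc : P.L1 + P.μ ≤ c) : P.μ ^ 2 * P.gapAccuracy / c ≤ P.meritAccuracy := by
  unfold meritAccuracy
  gcongr

end Params

/-- The distance to the regularized saddle point is halved by every restart. -/
theorem norm_restart_sub_le {P : Params} {g : Pair n m → ℝ} {z₁ zr : Pair n m}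
    {zt w : ℕ → Pair n m} {k : ℕ} (hp : 1 ≤ P.p) (hLp : 0 < P.Lp) (hR : 0 < P.R) (hε : 0 < P.ε)
    (hεp : P.p = 1 → P.ε ≤ 4 * P.R * P.Lp) (hg : ConvexConcave g) (hd : Differentiable ℝ g)
    (hC : ContDiff ℝ (P.p : ℕ) g) (hLip : LipschitzDeriv P.p P.Lp g)
    (hr : saddleOp (regularized g P.μ z₁) zr = 0) (hz : ‖z₁ - zr‖ ≤ P.R)
    (hrun : IsRun P g z₁ zt w k) {i : ℕ} (hi : i ≤ P.restarts) :
    ‖zt i - zr‖ ≤ P.R / 2 ^ i := by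
  have hμ := P.μ_pos hR hε
  induction i with
  | zero => simpa [hrun.start] using hz
  | succ i ih =>
    obtain ⟨hT0, hT1⟩ := P.innerIters_spec hLp hR hε i
    have hμL : P.p = 1 → P.μ ≤ P.Lp := fun h => by
      rw [Params.μ, div_le_iff₀ (by positivity)]
      linarith [hεp h]
    have h1 := (hrun.restart i (by omega)).dist_le_half hp hLp hμ (by positivity)
      (norm_saddleOp_regularized_sub_taylorApprox_le hp hLp.le hμ.le hμL hC hLip z₁)
      (fun z => by
        have := stronglyMonotone_regularized hg hd P.μ z₁ z zr
        rwa [hr, sub_zero] at this)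
      (ih (by omega)) hT0 hT1
    calc _ ≤ _ := h1
      _ = _ := by
        rw [pow_succ]
        field_simp

/-- The residuals of the cubic-regularized Newton method decrease geometrically. -/
theorem newton_geometric {F : Pair n m → Pair n m} {w : ℕ → Pair n m} {μ L : ℝ} {k : ℕ}
    (hL : 0 ≤ L) (hstart : L * ‖F (w 0)‖ ≤ μ ^ 2)
    (hdec : ∀ i < k, L * ‖F (w i)‖ ≤ μ ^ 2 → ‖F (w (i + 1))‖ ≤ 4 / 5 * ‖F (w i)‖) :
    ∀ i, i + 1 ≤ k → L * ‖F (w (i + 1))‖ ≤ μ ^ 2 ∧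
      ‖F (w (i + 1))‖ ^ 2 ≤ (16 / 25) ^ i * ‖F (w 1)‖ ^ 2 := by
  intro i hi
  induction i with
  | zero =>
    refine ⟨?_, by simp⟩
    have h1 := hdec 0 hi hstart
    have h0 := norm_nonneg (F (w 0))
    exact (mul_le_mul_of_nonneg_left (h1.trans (by linarith)) hL).trans hstart
  | succ i ih =>
    obtain ⟨h1, h2⟩ := ih (by omega)
    have h3 := hdec (i + 1) (by omega) h1
    have h0 := norm_nonneg (F (w (i + 1)))
    refine ⟨(mul_le_mul_of_nonneg_left (h3.trans (by linarith)) hL).trans h1, ?_⟩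
    have h4 := pow_le_pow_left₀ (norm_nonneg _) h3 2
    rw [pow_succ (16 / 25 : ℝ)]
    linarith

/-- If the stopping criterion is not met after `j + 1` Newton iterations, then `μ ε'` is at most
`(16 / 25) ^ j * ε ^ 2`. For `L₁ ≤ μ` the residual is below `ε` from the start. For `μ < L₁` the
first iteration brings it below `ε / (2 ξ)`: the residual is then quadratic in the distance, which is
bounded by `R` as well as by `μ / (2 L₂ ξ)`. So no double logarithm of `ξ` enters. -/
theorem gapAccuracy_le_of_not_stopped {P : Params} {g : Pair n m → ℝ} {z₁ zr : Pair n m}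
    {w : ℕ → Pair n m} {k : ℕ} (hp : 1 ≤ P.p)
    (hL1 : 0 < P.L1) (hL2 : 0 < P.L2) (hLp : 0 < P.Lp) (hR : 0 < P.R) (hε : 0 < P.ε)
    (hρ : 0 ≤ P.ρ) (hρ1 : P.ρ ≤ 1) (hg : ConvexConcave g) (hC : ContDiff ℝ (2 : ℕ) g)
    (hLip1 : LipschitzDeriv 1 P.L1 g) (hLip2 : LipschitzDeriv 2 P.L2 g)
    (hr : saddleOp (regularized g P.μ z₁) zr = 0) (hw0 : ‖w 0 - zr‖ ≤ P.R)
    (hw1 : 2 * P.L2 * P.ξ * ‖w 0 - zr‖ ≤ P.μ)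
    (hnewton : ∀ j < k, P.meritAccuracy < merit (regularized g P.μ z₁) (w j) ∧
      CubicNewtonStep (regularized g P.μ z₁) P.μ P.γbar P.ρ P.α (w j) (w (j + 1)))
    {j : ℕ} (hj : j + 1 < k) :
    P.μ * P.gapAccuracy ≤ (16 / 25) ^ j * P.ε ^ 2 := by
  have hμ := P.μ_pos hR hε
  have hξ1 := P.one_le_ξ
  have hL1ξ := P.L1_le_μ_mul_ξ hR hε
  have hgap := P.gapAccuracy_pos hp hLp hε
  have hεR := P.ε_eq hR
  have hd : Differentiable ℝ g := hC.differentiable (by norm_num)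
  have hC' := contDiff_regularized hC P.μ z₁
  set f := regularized g P.μ z₁ with hf
  have hm := stronglyMonotone_regularized hg hd P.μ z₁
  rw [← hf] at hm
  have hFd : Differentiable ℝ (saddleOp f) :=
    (contDiff_saddleOp (k := 1) hC').differentiable (by norm_num)
  have hB : ∀ z e, P.μ * ‖e‖ ^ 2 ≤ inner ℝ (fderiv ℝ (saddleOp f) z e) e := fun z e =>
    mul_norm_sq_le_inner_fderiv hm (hFd z) e
  have hT : ∀ z x, ‖saddleOp f x - (saddleOp f z + fderiv ℝ (saddleOp f) z (x - z))‖ ≤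
      P.L2 / 2 * ‖x - z‖ ^ 2 := by
    intro z x
    have h := norm_saddleOp_regularized_sub_taylorApprox_le_of_two_le le_rfl P.μ hC hLip2 z₁ z x
    rw [← hf, show 2 - 1 = 1 from rfl, taylorApprox_one] at h
    simpa using h
  have hγ0 : 0 ≤ P.γbar := by
    unfold Params.γbar
    positivity
  set D := ‖w 0 - zr‖ with hD
  have hD0 : 0 ≤ D := norm_nonneg _
  have hr0 : ‖saddleOp f (w 0)‖ ≤ (P.L1 + P.μ) * D := by
    have h := norm_saddleOp_regularized_sub_le hμ.le (hC.of_le (by norm_num)) hLip1 z₁ (w 0) zr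
    rwa [hr, sub_zero] at h
  -- the region of geometric decrease
  have hstart : P.L2 * ‖saddleOp f (w 0)‖ ≤ P.μ ^ 2 := by
    have h1 : P.L2 * ‖saddleOp f (w 0)‖ ≤ P.L2 * (2 * P.μ * P.ξ * D) := by
      gcongr
      refine hr0.trans ?_
      gcongr
      nlinarith
    nlinarith
  have hdec : ∀ i < k, P.L2 * ‖saddleOp f (w i)‖ ≤ P.μ ^ 2 →
      ‖saddleOp f (w (i + 1))‖ ≤ 4 / 5 * ‖saddleOp f (w i)‖ := by
    intro i hi hq
    obtain ⟨γ, d, hγ, -, hacc, hst, hle⟩ :=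
      (hnewton i hi).2.exists_direction hC' hγ0 hρ hρ1
    have hT' := hT (w i) (w i + d)
    rw [add_sub_cancel_left] at hT'
    exact hle.trans (norm_newton_le hμ hγ (hB _ _) hT' hst hacc hq)
  have hsq := (newton_geometric hL2.le hstart hdec j (by omega)).2
  have hmerit := (hnewton (j + 1) hj).1
  unfold merit at hmerit
  have hq0 : (0 : ℝ) < (16 / 25) ^ j := by positivity
  rcases le_or_gt P.L1 P.μ with hcase | hcase
  · -- a well conditioned problem: already the initial residual is at most `ε / 2`
    have h1 := Params.le_meritAccuracy hL1 hμ hgap (c := 2 * P.μ) (by linarith)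
    have e1 : P.μ ^ 2 * P.gapAccuracy / (2 * P.μ) = P.μ * P.gapAccuracy / 2 := by field_simp
    rw [e1] at h1
    have h2 : ‖saddleOp f (w 1)‖ ≤ P.ε := by
      have h3 := hdec 0 (by omega) hstart
      have h4 : (P.L1 + P.μ) * D ≤ 2 * P.μ * P.R := by
        gcongr
        linarith
      rw [zero_add] at h3
      nlinarith [mul_pos hμ hR]
    have h5 := mul_le_mul_of_nonneg_left (pow_le_pow_left₀ (norm_nonneg _) h2 2) hq0.le
    linarith
  · -- an ill conditioned problem: the regularization of the first step is small
    have h1 := Params.le_meritAccuracy hL1 hμ hgap (c := 2 * (P.μ * P.ξ)) (by linarith)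
    have e1 : P.μ ^ 2 * P.gapAccuracy / (2 * (P.μ * P.ξ)) = P.μ * P.gapAccuracy / (2 * P.ξ) := by
      field_simp
    rw [e1] at h1
    obtain ⟨γ, d, hγ, hγb, hacc, hst, hle⟩ :=
      (hnewton 0 (by omega)).2.exists_direction hC' hγ0 hρ hρ1
    have hγL : γ ≤ P.L2 / 2 := by
      refine hγb.trans ?_
      unfold Params.γbar
      rw [div_le_div_iff₀ (by positivity) (by norm_num)]
      have : P.μ ^ 2 ≤ P.L1 ^ 2 := by gcongr
      nlinarith
    have hclose : 2 * P.L2 * ‖w 0 - zr‖ ≤ P.μ := by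
      refine le_trans ?_ hw1
      have : 0 ≤ 2 * P.L2 * D := by positivity
      nlinarith
    have h2 := hle.trans (norm_newton_le_of_close hμ hγ hγL (hB (w 0)) (hT (w 0)) hst hr hclose)
    rw [zero_add, ← hD] at h2
    have h3 : P.ξ * ‖saddleOp f (w 1)‖ ≤ P.ε / 2 := by
      have h4 : P.ξ * (P.L2 * D ^ 2) ≤ P.μ * P.R / 2 := by
        have h5 : (2 * P.L2 * P.ξ * D) * D ≤ P.μ * P.R := mul_le_mul hw1 hw0 hD0 hμ.le
        linarith
      have h6 := mul_le_mul_of_nonneg_left h2 (zero_le_one.trans hξ1)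
      have h7 := mul_pos hμ hR
      linarith
    have h7 : P.μ * P.gapAccuracy / (2 * P.ξ) <
        1 / 2 * ((16 / 25) ^ j * ‖saddleOp f (w 1)‖ ^ 2) := by linarith
    rw [div_lt_iff₀ (by positivity)] at h7
    have h8 : P.ξ * ‖saddleOp f (w 1)‖ ^ 2 ≤ P.ε ^ 2 := by
      have h9 : ‖saddleOp f (w 1)‖ ≤ P.ξ * ‖saddleOp f (w 1)‖ :=
        le_mul_of_one_le_left (norm_nonneg _) hξ1
      have h10 : (P.ξ * ‖saddleOp f (w 1)‖) * ‖saddleOp f (w 1)‖ ≤ (P.ε / 2) * (P.ε / 2) :=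
        mul_le_mul h3 (h9.trans h3) (norm_nonneg _) (by positivity)
      have h11 : P.ξ * ‖saddleOp f (w 1)‖ ^ 2 ≤ (P.ε / 2) * (P.ε / 2) := by
        rw [sq, ← mul_assoc]
        exact h10
      linarith [sq_nonneg P.ε]
    have h11 := mul_le_mul_of_nonneg_left h8 hq0.le
    linarith

end Complexity

theorem theorem4 (p : ℕ) (hp : 1 ≤ p) :
    ∃ C : ℝ, 0 < C ∧
      ∀ (n m : ℕ) (P : Params) (g : Pair n m → ℝ) (z₁ zs : Pair n m),
        P.p = p →
        0 < P.L1 → 0 < P.L2 → 0 < P.Lp → 0 < P.R → 0 < P.ε →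
        0 < P.ρ → P.ρ < 1 → 0 < P.α → P.α < 1 →
        (p = 1 → P.ε ≤ 4 * P.R * P.Lp) →
        ConvexConcave g →
        ContDiff ℝ (max p 2 : ℕ) g →
        LipschitzDeriv 1 P.L1 g → LipschitzDeriv 2 P.L2 g → LipschitzDeriv p P.Lp g →
        IsSaddle g zs → ‖z₁ - zs‖ ≤ P.R →
        ∀ (zt w : ℕ → Pair n m) (k : ℕ), IsRun P g z₁ zt w k →
          (P.iterations k : ℝ) ≤
              C * max 1 (P.Lp * P.R ^ p / P.ε) ^ ((2 : ℝ) / ((p : ℝ) + 1)) *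
                max 1 (Real.log (P.L2 * P.R ^ 2 * P.ξ / P.ε)) ∧
            ∀ out : Pair n m, IsOutput P g z₁ w k out → ‖∇ g out‖ ≤ P.ε := by
  set B : ℝ := Real.sqrt 2 ^ (2 * p ^ 2 + 3 * p + 3) * ((p : ℝ) * ((p + 1)! : ℝ)) ^ p *
    (Real.sqrt 2 * p) with hBdef
  have hB0 : 0 ≤ B := by positivity
  refine ⟨1545 + 8 * B, by positivity, ?_⟩
  intro n m P g z₁ zs hPp hL1 hL2 hLp hR hε hρ hρ1 _ _ hεp hg hC hLip1 hLip2 hLipp hs hz zt w k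
    hrun
  subst hPp
  have hμ := P.μ_pos hR hε
  have hC2 : ContDiff ℝ (2 : ℕ) g := hC.of_le (by exact_mod_cast le_max_right _ _)
  have hCp : ContDiff ℝ (P.p : ℕ) g := hC.of_le (by exact_mod_cast le_max_left _ _)
  have hd : Differentiable ℝ g := hC2.differentiable (by norm_num)
  have hm := stronglyMonotone_regularized hg hd P.μ z₁
  obtain ⟨zr, hr⟩ := exists_zero_of_stronglyMonotone hμ hm
    (norm_saddleOp_regularized_sub_le hμ.le (hC2.of_le (by norm_num)) hLip1 z₁)
  have hzr : ‖z₁ - zr‖ ≤ P.R :=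
    (norm_sub_le_of_saddleOp_regularized_eq_zero hg hd hμ hs hr).trans hz
  constructor
  · have hw : ‖w 0 - zr‖ ≤ P.R / 2 ^ P.restarts := by
      rw [hrun.switch]
      exact norm_restart_sub_le hp hLp hR hε hεp hg hd hCp hLipp hr hzr hrun le_rfl
    have hw0 : ‖w 0 - zr‖ ≤ P.R := hw.trans (div_le_self hR.le (one_le_pow₀ (by norm_num)))
    have hw1 : 2 * P.L2 * P.ξ * ‖w 0 - zr‖ ≤ P.μ := by
      have hξ := P.one_le_ξ
      exact (mul_le_mul_of_nonneg_left hw (by positivity)).trans (P.restarts_spec hL2 hR hε)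
    have hεR := P.ε_mul_R_le hp hLp hR hε
    rw [← hBdef] at hεR
    have hgap := P.gapAccuracy_pos hp hLp hε
    have hN := P.restarts_le hL2 hR hε
    have hI := P.innerIters_le hp hLp hR hε
    set Q := max 1 (P.Lp * P.R ^ P.p / P.ε) ^ ((2 : ℝ) / ((P.p : ℝ) + 1)) with hQ
    have hQ1 : 1 ≤ Q := Real.one_le_rpow (le_max_left _ _) (by positivity)
    set Λ := max 1 (Real.log (P.L2 * P.R ^ 2 * P.ξ / P.ε)) with hΛ
    have hΛ1 : 1 ≤ Λ := le_max_left _ _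
    have hk : (k : ℝ) ≤ (2 + 8 * B) * Q := by
      rcases lt_or_ge k 2 with hk | hk
      · have : (k : ℝ) ≤ 2 := by exact_mod_cast hk.le
        nlinarith [mul_nonneg hB0 (zero_le_one.trans hQ1)]
      · obtain ⟨j, rfl⟩ : ∃ j, k = j + 2 := ⟨k - 2, by omega⟩
        have h1 := gapAccuracy_le_of_not_stopped hp hL1 hL2 hLp hR hε hρ.le hρ1.le hg hC2 hLip1
          hLip2 hr hw0 hw1 hrun.newton (j := j) (by omega)
        have h2 : (25 / 16 : ℝ) ^ j ≤ 4 * B * Q := by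
          have e1 : (16 / 25 : ℝ) ^ j * (25 / 16) ^ j = 1 := by
            rw [← mul_pow]
            norm_num
          have h3 : (25 / 16 : ℝ) ^ j * (P.μ * P.gapAccuracy) ≤ P.ε ^ 2 := by
            have := mul_le_mul_of_nonneg_right h1 (show (0 : ℝ) ≤ (25 / 16) ^ j by positivity)
            linear_combination this + P.ε ^ 2 * e1
          have h4 : P.ε ^ 2 ≤ 4 * B * Q * (P.μ * P.gapAccuracy) := by
            have h5 : P.ε ^ 2 = 4 * P.μ * (P.ε * P.R) := by
              linear_combination P.ε * P.ε_eq hR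
            rw [h5]
            nlinarith
          exact le_of_mul_le_mul_right (h3.trans h4) (mul_pos hμ hgap)
        have h6 := one_add_mul_le_pow (show (-2 : ℝ) ≤ 9 / 16 by norm_num) j
        norm_num at h6
        push_cast
        nlinarith
    have hsum : ((∑ i ∈ Finset.range P.restarts, P.innerIters i : ℕ) : ℝ) ≤ 1542 * (Q * Λ) := by
      push_cast
      calc ∑ i ∈ Finset.range P.restarts, (P.innerIters i : ℝ)
          ≤ ∑ i ∈ Finset.range P.restarts, 257 * Q := Finset.sum_le_sum fun i _ => hI i
        _ = P.restarts * (257 * Q) := by simp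
        _ ≤ 6 * Λ * (257 * Q) := by gcongr
        _ = _ := by ring
    unfold Params.iterations
    push_cast at hsum ⊢
    have h7 : (2 + 8 * B) * Q ≤ (2 + 8 * B) * (Q * Λ) := by
      gcongr
      exact le_mul_of_one_le_right (zero_le_one.trans hQ1) hΛ1
    have h8 : 1 ≤ Q * Λ := one_le_mul_of_one_le_of_one_le hQ1 hΛ1
    linarith
  · intro out hout
    have h1 := norm_saddleOp_tensorStep_le (z := w k) hp hL1 hLp hR hε hεp hg hd hCp hLipp hout
    have h2 := mul_norm_sub_le_of_stronglyMonotone (hm out zr)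
    rw [hr, sub_zero] at h2
    rw [← norm_saddleOp]
    have e : saddleOp g out =
        saddleOp (regularized g P.μ z₁) out - (P.μ • (out - zr) + P.μ • (zr - z₁)) := by
      rw [saddleOp_regularized hd, ← smul_add, sub_add_sub_cancel, add_sub_cancel_right]
    have h3 : ‖P.μ • (out - zr)‖ ≤ 3 / 8 * P.ε := by
      rw [norm_smul, Real.norm_of_nonneg hμ.le]
      exact h2.trans h1
    have h4 : ‖P.μ • (zr - z₁)‖ ≤ P.ε / 4 := by
      rw [norm_smul, Real.norm_of_nonneg hμ.le, norm_sub_rev]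
      have h5 := mul_le_mul_of_nonneg_left hzr hμ.le
      linarith [P.ε_eq hR]
    rw [e]
    have h6 := norm_sub_le (saddleOp (regularized g P.μ z₁) out)
      (P.μ • (out - zr) + P.μ • (zr - z₁))
    have h7 := norm_add_le (P.μ • (out - zr)) (P.μ • (zr - z₁))
    linarith
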